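/- Fix an integer $k_m>1$, reals $\nu,\eta>0$, $\theta\in[0,1]$ and $\lambda\ge 0$, and put $\bar\lambda=\theta\lambda$; assume $0<\bar\lambda<e^{-1}$. For $\rho\ge0$ let $q_0(\rho)=e^{-\rho}$, $q_1(\rho)=\rho e^{-\rho}$, $q_c(\rho)=1-q_0(\rho)-q_1(\rho)$, let $$\mu(\nu,q,k_m)=\sum_{k=1}^{k_m-1}k^\nu q^{k-1}(1-q)+k_m^\nu q^{k_m-1},$$ $h_0=\eta\,[q_0(1)\,\mu(\nu,q_0(1),k_m)]^{-1}$, $h_c=\eta\,[q_c(1)\,\mu(\nu,q_c(1),k_m)]^{-1}$, and $$\psi(\rho)=-q_0(\rho)\,[1+h_0\,\mu(\nu,q_0(\rho),k_m)]+q_c(\rho)\Big[\tfrac1{e-2}+h_c\,\mu(\nu,q_c(\rho),k_m)\Big]-(\bar\lambda-\rho e^{-\rho}).$$ The FASA chain $X_t=(N_t,\hat N_t,K_t)$ is the time-homogeneous Markov chain on the set of all $(n,\hat n,k)$ with $n\in\mathbb{Z}_{\ge0}$, $\hat n\in[1,\infty)$, $k\in\{-k_m,\dots,k_m\}$ that evolves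 as follows. In slot $t$, given the past, each of the $N_t$ backlogged devices transmits independently with probability $1/\hat N_t$; the outcome $Z_t$ is $0$, $1$ or $c$ according to whether none, exactly one, or at least two of them transmit. Independently of this and of the past, $A_t$ devices arrive, where $A_t$ is Poisson with mean $\lambda$ with probability $\theta$, and $A_t=0$ with probability $1-\theta$. Then $$N_{t+1}=\max\{0,\,N_t+A_t-I(Z_t=1)\},$$ $$K_{t+1}=\begin{cases}-\min\{|K_t|+1,k_m\}& Z_t=0,\ K_t<0,\\ -1& Z_t=0,\ K_t\ge0,\\ 0& Z_t=1,\\ 1& Z_t=c,\ K_t\le0,\\ \min\{K_t+1,k_m\}& Z_t=c,\ K_t>0,\end{cases}$$ $$\hat N_{t+1}=\begin{cases}\max\{1,\ \hat N_t-1-h_0|K_{t+1}|^\nu\}& Z_t=0,\\ \hat N_t& Z_t=1,\\ \hat N_t+\frac1{e-2}+h_c\,(K_{t+1})^\nu& Z_t=c.\end{cases}$$ Define the $T$-slot drifts of the backlog and of the estimate error: $$d_T(n,\hat n,k)=E[N_{t+T}-N_t\mid X_t=(n,\hat n,k)],$$ $$\tilde d_T(n,\hat n,k)=E[(\hat N_{t+T}-N_{t+T})-(\hat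 N_t-N_t)\mid X_t=(n,\hat n,k)].$$ Then $\psi$ has a unique zero $\beta$ in $(0,1]$, and there exist $\gamma>0$, $\delta>0$, an integer $T>0$ and $M>0$ such that $5\gamma<\beta$ and, for all states $(n,\hat n,k)$: 1. if ($n\ge M$ or $\hat n\ge M$) and $\beta-5\gamma\le n/\hat n\le 1+5\gamma$, then $d_T(n,\hat n,k)\le -T\delta$; 2. if $\hat n\ge M$ and $n/\hat n<\beta-\gamma$, then $\tilde d_T(n,\hat n,k)\le -T\delta$; 3. if $n\ge M$ and $n/\hat n>1+\gamma$, then $\tilde d_T(n,\hat n,k)\ge T\delta$. -/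

import Mathlib

open scoped NNReal

namespace FASA

noncomputable section

/-- Result of a slot: no packet, exactly one packet, or at least two packets transmitted. -/
inductive Outcome
  | idle
  | success
  | collision

/-- A state `(n, n̂, k)`: number of backlogged devices, its estimate, and the signed memory of the
current run of idle slots (`k < 0`) or collision slots (`k > 0`). -/
abbrev State : Type := ℕ × ℝ × ℤ

/-- The number `n` of backlogged devices. -/
abbrev backlog (x : State) : ℕ := x.1

/-- The estimate `n̂` of the number of backlogged devices. -/
abbrev estimate (x : State) : ℝ := x.2.1

/-- The memory `k`. -/
abbrev memory (x : State) : ℤ := x.2.2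

/-! ### Design functions -/

/-- `q₀(ρ) = e^{-ρ}`. -/
def q0 (ρ : ℝ) : ℝ := Real.exp (-ρ)

/-- `q₁(ρ) = ρ e^{-ρ}`. -/
def q1 (ρ : ℝ) : ℝ := ρ * Real.exp (-ρ)

/-- `q_c(ρ) = 1 - q₀(ρ) - q₁(ρ)`. -/
def qc (ρ : ℝ) : ℝ := 1 - q0 ρ - q1 ρ

/-- `μ(ν, q, k_m) = ∑_{k=1}^{k_m-1} k^ν q^{k-1} (1-q) + k_m^ν q^{k_m-1}`. -/
def mu (ν q : ℝ) (km : ℕ) : ℝ :=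
  (∑ k ∈ Finset.Icc 1 (km - 1), (k : ℝ) ^ ν * q ^ (k - 1) * (1 - q)) + (km : ℝ) ^ ν * q ^ (km - 1)

/-- `h₀(ν) = η / (q₀(1) μ(ν, q₀(1), k_m))`. -/
def h0 (km : ℕ) (ν η : ℝ) : ℝ := η * (q0 1 * mu ν (q0 1) km)⁻¹

/-- `h_c(ν) = η / (q_c(1) μ(ν, q_c(1), k_m))`. -/
def hc (km : ℕ) (ν η : ℝ) : ℝ := η * (qc 1 * mu ν (qc 1) km)⁻¹

/-- The stationary approximate drift `φ(ρ)` of the estimate. -/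
def phi (km : ℕ) (ν η : ℝ) (ρ : ℝ) : ℝ :=
  -(q0 ρ * (1 + h0 km ν η * mu ν (q0 ρ) km))
    + qc ρ * ((Real.exp 1 - 2)⁻¹ + hc km ν η * mu ν (qc ρ) km)

/-- The approximate drift of the estimate error,
`ψ(ρ, lbar) = φ(ρ) - (lbar - ρ e^{-ρ})`. -/
def psi (km : ℕ) (ν η : ℝ) (ρ lbar : ℝ) : ℝ :=
  phi km ν η ρ - (lbar - ρ * Real.exp (-ρ))

/-! ### The Markov chain -/

/-- Transmission probability `1 / n̂`; the projection to `[0, 1]` changes nothing as `n̂ ≥ 1`. -/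
def txProb (nhat : ℝ) : unitInterval := Set.projIcc 0 1 zero_le_one (1 / nhat)

/-- The outcome of a slot in which `m` packets are transmitted. -/
def outcomeOf : ℕ → Outcome
  | 0 => .idle
  | 1 => .success
  | _ + 2 => .collision

/-- Law of the outcome of a slot: each of the `n` backlogged devices transmits independently with
probability `1 / n̂`. -/
def outcomeLaw (n : ℕ) (nhat : ℝ) : PMF Outcome :=
  (ProbabilityTheory.binomial n (txProb nhat)).toPMF.map outcomeOf

/-- Law of the number of arrivals in a slot: with probability `θ` an event happens and the number
is Poisson with mean `lam`; otherwise there are no arrivals. -/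
def arrivalLaw (θ : unitInterval) (lam : ℝ≥0) : PMF ℕ :=
  (ProbabilityTheory.bernoulliMeasure true false θ).toPMF.bind fun event =>
    if event then (ProbabilityTheory.poissonMeasure lam).toPMF else PMF.pure 0

/-- `N_{t+1} = max {0, N_t + A_t - I(Z_t = 1)}` (subtraction in `ℕ` is truncated at `0`). -/
def nextBacklog (n a : ℕ) : Outcome → ℕ
  | .success => n + a - 1
  | _ => n + a

/-- Update of the memory, run lengths being truncated at `km`. -/
def nextMemory (km : ℕ) (k : ℤ) : Outcome → ℤ
  | .idle => if k < 0 then -(min (|k| + 1) (km : ℤ)) else -1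
  | .success => 0
  | .collision => if 0 < k then min (k + 1) (km : ℤ) else 1

/-- Update of the estimate; `k'` is the already updated memory. -/
def nextEstimate (km : ℕ) (ν η : ℝ) (nhat : ℝ) (k' : ℤ) : Outcome → ℝ
  | .idle => max 1 (nhat - 1 - h0 km ν η * |(k' : ℝ)| ^ ν)
  | .success => nhat
  | .collision => nhat + 1 / (Real.exp 1 - 2) + hc km ν η * (k' : ℝ) ^ ν

/-- The next state, given the arrivals and the outcome of the slot. -/
def nextState (km : ℕ) (ν η : ℝ) (x : State) (a : ℕ) (z : Outcome) : State :=
  (nextBacklog (backlog x) a z,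
    nextEstimate km ν η (estimate x) (nextMemory km (memory x) z) z,
    nextMemory km (memory x) z)

/-- One-slot transition law of the chain: arrivals and outcome are independent given the state. -/
def step (km : ℕ) (ν η : ℝ) (θ : unitInterval) (lam : ℝ≥0) (x : State) : PMF State :=
  (outcomeLaw (backlog x) (estimate x)).bind fun z =>
    (arrivalLaw θ lam).map fun a => nextState km ν η x a z

/-- `T`-slot transition law: the conditional law of `X_{t+T}` given `X_t = x`. -/
def transition (km : ℕ) (ν η : ℝ) (θ : unitInterval) (lam : ℝ≥0) : ℕ → State → PMF State
  | 0, x => PMF.pure x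
  | T + 1, x => (step km ν η θ lam x).bind (transition km ν η θ lam T)

/-- `d_T(x) = E[N_{t+T} - N_t | X_t = x]`. -/
def backlogDrift (km : ℕ) (ν η : ℝ) (θ : unitInterval) (lam : ℝ≥0) (T : ℕ) (x : State) : ℝ :=
  ∫ y, ((backlog y : ℝ) - (backlog x : ℝ)) ∂(transition km ν η θ lam T x).toMeasure

/-- `d̃_T(x) = E[(N̂_{t+T} - N_{t+T}) - (N̂_t - N_t) | X_t = x]`. -/
def errorDrift (km : ℕ) (ν η : ℝ) (θ : unitInterval) (lam : ℝ≥0) (T : ℕ) (x : State) : ℝ :=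
  ∫ y, ((estimate y - (backlog y : ℝ)) - (estimate x - (backlog x : ℝ)))
    ∂(transition km ν η θ lam T x).toMeasure

/-! ### Regions of the state space -/

/-- All `(n, n̂, k)` with `n ∈ ℕ`, `n̂ ≥ 1` real and `-km ≤ k ≤ km`. -/
def stateSpace (km : ℕ) : Set State :=
  {x | 1 ≤ estimate x ∧ -(km : ℤ) ≤ memory x ∧ memory x ≤ (km : ℤ)}

/-- The region `S_{γ,M}`. -/
def regionS (km : ℕ) (β γ M : ℝ) : Set State :=
  {x ∈ stateSpace km | (M ≤ (backlog x : ℝ) ∨ M ≤ estimate x) ∧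
    β - γ ≤ (backlog x : ℝ) / estimate x ∧ (backlog x : ℝ) / estimate x ≤ 1 + γ}

/-- The region `R⁻_{γ,M}`. -/
def regionRminus (km : ℕ) (β γ M : ℝ) : Set State :=
  {x ∈ stateSpace km | M ≤ estimate x ∧ (backlog x : ℝ) / estimate x < β - γ}

/-- The region `R⁺_{γ,M}`. -/
def regionRplus (km : ℕ) (γ M : ℝ) : Set State :=
  {x ∈ stateSpace km | M ≤ (backlog x : ℝ) ∧ 1 + γ < (backlog x : ℝ) / estimate x}

end

end FASA

/-! In a large state a few slots hardly change the load ρ = n/n̂. Outcomes then behave like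
independent draws from the Poisson law (q₀(ρ), q₁(ρ), q_c(ρ)), or like collisions only if ρ is
infinite. The memory driven by such draws forgets its start after `km` slots, and its mean
increments produce μ. Hence the T-slot backlog drift is close to T(λ̄ - ρe^{-ρ}), and the error
drift is close to Tψ(ρ) up to an error independent of T.

The signs come from ψ. It increases strictly on [0, ∞) (`psi_lt_psi`), is negative at 0 and equals
e^{-1} - λ̄ > 0 at 1, because h₀ and h_c are normalised so that φ(1) = 0 (`phi_one`). This gives β
and the signs of ψ on both sides of the middle region. On [β, 1) the identity ρe^{-ρ} - λ̄ = ψ - φ,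
with ψ ≥ 0 > φ, makes the backlog drift negative. At 1 this is the hypothesis λ̄ < e^{-1}.

Uniformity over states is proved by contradiction (`exists_threshold`): counterexamples at ever
larger thresholds are followed along an ultrafilter, on which the memory is constant and the load
has a limit in [0, ∞] (`finiteLoad_or_overload`). The drifts of each slot converge there
(`tendsto_driftAt`), and the limit violates the supposed inequality. -/

namespace PMF

/-! ### Expectations under a `PMF` as series -/

variable {α β : Type*}

theorem hasSum_toReal (p : PMF α) : HasSum (fun a => (p a).toReal) 1 := by
  have h := (ENNReal.summable_toReal p.tsum_coe_ne_top).hasSum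
  rwa [← ENNReal.tsum_toReal_eq p.apply_ne_top, p.tsum_coe, ENNReal.toReal_one] at h

theorem toReal_bind_apply (p : PMF α) (κ : α → PMF β) (y : β) :
    ((p.bind κ) y).toReal = ∑' a, (p a).toReal * (κ a y).toReal := by
  rw [bind_apply, ENNReal.tsum_toReal_eq
    fun a => ENNReal.mul_ne_top (p.apply_ne_top a) ((κ a).apply_ne_top y)]
  simp

/-- Indexing by the support keeps the sum countable even when the type is not, as with the real
coordinate of `State`; integrals then become series. -/
theorem toMeasure_eq_sum_dirac [MeasurableSpace α] (p : PMF α) :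
    p.toMeasure = MeasureTheory.Measure.sum
      fun a : p.support => p a • MeasureTheory.Measure.dirac (a : α) := by
  ext s hs
  rw [p.toMeasure_apply hs, MeasureTheory.Measure.sum_apply _ hs,
    ← tsum_subtype_eq_of_support_subset (s := p.support)]
  · refine tsum_congr fun a => ?_
    by_cases ha : (a : α) ∈ s <;> simp [hs, ha]
  · intro a ha
    exact fun h => ha (by simp [h])

/-- For real-valued functions no integrability is needed: both sides have the same junk value. -/
theorem integral_toMeasure_eq_tsum [MeasurableSpace α] [MeasurableSingletonClass α]
    (p : PMF α) (f : α → ℝ) :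
    ∫ a, f a ∂p.toMeasure = ∑' a, (p a).toReal * f a := by
  have := p.support_countable.to_subtype
  rw [toMeasure_eq_sum_dirac, MeasureTheory.integral_sum_dirac (ι := p.support) (x := Subtype.val)
      (c := fun a => p a) fun a => p.apply_ne_top a,
    ← tsum_subtype_eq_of_support_subset (s := p.support) (f := fun a => (p a).toReal * f a)]
  · simp
  · intro a ha
    exact fun h => ha (by simp [h])

/-- Fubini for a nonnegative mixture of series. -/
theorem hasSum_mixture {w : α → ℝ} {k : α → β → ℝ} (hw : ∀ a, 0 ≤ w a) (hk : ∀ a y, 0 ≤ k a y)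
    {f : β → ℝ} {b : α → ℝ} (hf : ∀ a, Summable fun y => k a y * f y)
    (hb : ∀ a, ∑' y, k a y * |f y| ≤ b a) (hs : Summable fun a => w a * b a) :
    HasSum (fun y => (∑' a, w a * k a y) * f y) (∑' a, w a * ∑' y, k a y * f y) := by
  have habs : ∀ a, Summable fun y => k a y * |f y| := fun a => by
    have := (hf a).abs
    simpa only [abs_mul, abs_of_nonneg (hk a _)] using this
  have hs' : Summable fun a => w a * ∑' y, k a y * |f y| :=
    hs.of_nonneg_of_le (fun a => mul_nonneg (hw a) (tsum_nonneg fun y =>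
      mul_nonneg (hk a y) (abs_nonneg _))) fun a => mul_le_mul_of_nonneg_left (hb a) (hw a)
  have hA : Summable fun x : α × β => w x.1 * (k x.1 x.2 * |f x.2|) := by
    have h0 : 0 ≤ fun x : α × β => w x.1 * (k x.1 x.2 * |f x.2|) :=
      fun x => mul_nonneg (hw _) (mul_nonneg (hk _ _) (abs_nonneg _))
    refine (summable_prod_of_nonneg h0).2 ⟨fun a => (habs a).mul_left (w a), ?_⟩
    simp only [tsum_mul_left]
    exact hs'
  have hF : Summable fun x : α × β => w x.1 * (k x.1 x.2 * f x.2) := by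
    refine hA.of_norm_bounded fun x => le_of_eq ?_
    rw [Real.norm_eq_abs, abs_mul, abs_mul, abs_of_nonneg (hw _), abs_of_nonneg (hk _ _)]
  have h1 := hF.hasSum
  rw [hF.tsum_prod, ← (Equiv.prodComm β α).hasSum_iff] at h1
  simp only [tsum_mul_left] at h1
  refine h1.prod_fiberwise fun y => ?_
  have h2 : Summable fun a => w a * (k a y * f y) :=
    hF.comp_injective (i := fun a => (a, y)) fun a a' h => (Prod.ext_iff.1 h).1
  have h3 := h2.hasSum
  have h4 : ∑' a, w a * (k a y * f y) = (∑' a, w a * k a y) * f y := by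
    rw [← tsum_mul_right]
    exact tsum_congr fun a => by ring
  rwa [h4] at h3

/-- The tower property for a mixture `p.bind κ`. -/
theorem hasSum_bind {p : PMF α} {κ : α → PMF β} {f : β → ℝ} {m b : α → ℝ}
    (hm : ∀ a, HasSum (fun y => (κ a y).toReal * f y) (m a))
    (hb : ∀ a, ∑' y, (κ a y).toReal * |f y| ≤ b a)
    (hs : Summable fun a => (p a).toReal * b a) :
    HasSum (fun y => (p.bind κ y).toReal * f y) (∑' a, (p a).toReal * m a) ∧
      ∑' y, (p.bind κ y).toReal * |f y| ≤ ∑' a, (p a).toReal * b a := by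
  have hw : ∀ a, 0 ≤ (p a).toReal := fun a => ENNReal.toReal_nonneg
  have hk : ∀ a y, 0 ≤ (κ a y).toReal := fun a y => ENNReal.toReal_nonneg
  have habs : ∀ a, Summable fun y => (κ a y).toReal * |f y| := fun a => by
    have := (hm a).summable.abs
    simpa only [abs_mul, abs_of_nonneg (hk a _)] using this
  simp only [toReal_bind_apply]
  constructor
  · simpa only [fun a => (hm a).tsum_eq] using
      hasSum_mixture hw hk (fun a => (hm a).summable) hb hs
  · rw [(hasSum_mixture hw hk habs (by simpa only [abs_abs] using hb) hs).tsum_eq]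
    have hle := fun a => mul_le_mul_of_nonneg_left (hb a) (hw a)
    exact (hs.of_nonneg_of_le (fun a => mul_nonneg (hw a) (tsum_nonneg fun y =>
      mul_nonneg (hk a y) (abs_nonneg _))) hle).tsum_le_tsum hle hs

end PMF

/-! ### Outcome probabilities and the mean number of arrivals -/

namespace FASA

instance : Fintype Outcome where
  elems := ⟨↑[Outcome.idle, Outcome.success, Outcome.collision], by simp⟩
  complete := by rintro (_ | _ | _) <;> simp

theorem sum_outcome (f : Outcome → ℝ) :
    ∑ z, f z = f .idle + f .success + f .collision := by
  change (Multiset.map f ↑[Outcome.idle, .success, .collision]).sum = _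
  simp [add_assoc]

/-- Probability of the outcome `z` in state `x`. -/
noncomputable def outcomeProb (x : State) (z : Outcome) : ℝ :=
  (outcomeLaw (backlog x) (estimate x) z).toReal

/-- Probability of `a` arrivals in a slot. -/
noncomputable def arrivalProb (θ : unitInterval) (lam : ℝ≥0) (a : ℕ) : ℝ :=
  (arrivalLaw θ lam a).toReal

theorem outcomeProb_nonneg (x : State) (z : Outcome) : 0 ≤ outcomeProb x z :=
  ENNReal.toReal_nonneg

theorem arrivalProb_nonneg (θ : unitInterval) (lam : ℝ≥0) (a : ℕ) : 0 ≤ arrivalProb θ lam a :=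
  ENNReal.toReal_nonneg

theorem sum_outcomeProb (x : State) : ∑ z, outcomeProb x z = 1 :=
  (hasSum_fintype _).unique (outcomeLaw (backlog x) (estimate x)).hasSum_toReal

theorem hasSum_arrivalProb (θ : unitInterval) (lam : ℝ≥0) : HasSum (arrivalProb θ lam) 1 :=
  (arrivalLaw θ lam).hasSum_toReal

/-- The term n = 0 vanishes, and n λ^n / n! = λ · λ^(n-1) / (n-1)! reduces the rest to the total
mass. -/
theorem hasSum_poisson_mean (lam : ℝ≥0) :
    HasSum (fun n : ℕ => ((ProbabilityTheory.poissonMeasure lam).toPMF n).toReal * (n : ℝ))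
      lam := by
  have e : ∀ n : ℕ, ((ProbabilityTheory.poissonMeasure lam).toPMF n).toReal
      = Real.exp (-lam) * lam ^ n / n.factorial := fun n =>
    ProbabilityTheory.poissonMeasure_real_singleton lam n
  simp only [e]
  rw [← hasSum_nat_add_iff' 1]
  have h := (ProbabilityTheory.hasSum_one_poissonMeasure lam).mul_left (lam : ℝ)
  simp only [Finset.range_one, Finset.sum_singleton, Nat.cast_zero, mul_zero, sub_zero]
  rw [mul_one] at h
  refine h.congr_fun fun n => ?_
  have : (n.factorial : ℝ) ≠ 0 := by positivity
  have : (n : ℝ) + 1 ≠ 0 := by positivity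
  rw [Nat.factorial_succ]
  push_cast
  field_simp
  ring

theorem hasSum_arrivalProb_mul_nat (θ : unitInterval) (lam : ℝ≥0) :
    HasSum (fun a : ℕ => arrivalProb θ lam a * a) ((θ : ℝ) * lam) := by
  have hm : ∀ e : Bool, HasSum (fun n : ℕ => ((if e then
      (ProbabilityTheory.poissonMeasure lam).toPMF else PMF.pure 0) n).toReal * (n : ℝ))
      (if e then (lam : ℝ) else 0) := by
    rintro (_ | _)
    · refine hasSum_zero.congr_fun fun n => ?_
      rcases eq_or_ne n 0 with rfl | hn <;> simp [*]
    · simpa using hasSum_poisson_mean lam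
  have hs : Summable fun e : Bool =>
      ((ProbabilityTheory.bernoulliMeasure true false θ).toPMF e).toReal
        * (if e then (lam : ℝ) else 0) := (hasSum_fintype _).summable
  have h := (PMF.hasSum_bind hm (fun e => by simpa using (hm e).tsum_eq.le) hs).1
  have h2 : ((ProbabilityTheory.bernoulliMeasure true false θ).toPMF true).toReal = θ := by
    rw [MeasureTheory.Measure.toPMF_apply]
    exact (ProbabilityTheory.bernoulliMeasure_real_apply_of_mem_of_notMem θ (by simp)
      (by simp) (by simp))
  rw [tsum_fintype, Fintype.sum_bool, h2] at h
  simp only [if_true, Bool.false_eq_true, if_false, mul_zero, add_zero] at h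
  exact h

/-! ### Means over one slot -/

section Mean

variable (θ : unitInterval) (lam : ℝ≥0)

/-- Mean of `h z a` over the outcome `z` and the arrivals `a` of a slot that starts in `x`. -/
noncomputable def slotMean (x : State) (h : Outcome → ℕ → ℝ) : ℝ :=
  ∑ z, outcomeProb x z * ∑' a, arrivalProb θ lam a * h z a

variable {θ lam}

theorem summable_arrivalProb_mul {f : ℕ → ℝ} {C : ℝ} (hf : ∀ a, |f a| ≤ C * (1 + a)) :
    Summable fun a => arrivalProb θ lam a * f a := by
  have h := (((hasSum_arrivalProb θ lam).add (hasSum_arrivalProb_mul_nat θ lam)).mul_left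
    C).summable
  refine h.of_norm_bounded fun a => ?_
  rw [Real.norm_eq_abs, abs_mul, abs_of_nonneg (arrivalProb_nonneg _ _ _)]
  calc _ ≤ arrivalProb θ lam a * (C * (1 + a)) :=
        mul_le_mul_of_nonneg_left (hf a) (arrivalProb_nonneg _ _ _)
    _ = _ := by ring

theorem abs_tsum_arrivalProb_mul_le {f : ℕ → ℝ} {C : ℝ} (hf : ∀ a, |f a| ≤ C * (1 + a)) :
    |∑' a, arrivalProb θ lam a * f a| ≤ C * (1 + θ * lam) := by
  have h := ((hasSum_arrivalProb θ lam).add (hasSum_arrivalProb_mul_nat θ lam)).mul_left C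
  rw [← Real.norm_eq_abs]
  refine tsum_of_norm_bounded h fun a => ?_
  rw [Real.norm_eq_abs, abs_mul, abs_of_nonneg (arrivalProb_nonneg _ _ _)]
  calc _ ≤ arrivalProb θ lam a * (C * (1 + a)) :=
        mul_le_mul_of_nonneg_left (hf a) (arrivalProb_nonneg _ _ _)
    _ = _ := by ring

theorem abs_sum_outcomeProb_mul_le {x : State} {f : Outcome → ℝ} {C : ℝ} (hf : ∀ z, |f z| ≤ C) :
    |∑ z, outcomeProb x z * f z| ≤ C := by
  calc _ ≤ ∑ z, |outcomeProb x z * f z| := Finset.abs_sum_le_sum_abs _ _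
    _ ≤ ∑ z, outcomeProb x z * C := Finset.sum_le_sum fun z _ => by
        rw [abs_mul, abs_of_nonneg (outcomeProb_nonneg _ _)]
        exact mul_le_mul_of_nonneg_left (hf z) (outcomeProb_nonneg _ _)
    _ = C := by rw [← Finset.sum_mul, sum_outcomeProb, one_mul]

theorem abs_slotMean_le {x : State} {h : Outcome → ℕ → ℝ} {C : ℝ}
    (hf : ∀ z a, |h z a| ≤ C * (1 + a)) : |slotMean θ lam x h| ≤ C * (1 + θ * lam) :=
  abs_sum_outcomeProb_mul_le fun z => abs_tsum_arrivalProb_mul_le (hf z)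

/-- Averaging a bounded function loses no factor, which is why the bound in `abs_driftAt_le` does
not grow with the slot number. -/
theorem abs_tsum_arrivalProb_mul_le_of_bounded {f : ℕ → ℝ} {C : ℝ} (hf : ∀ a, |f a| ≤ C) :
    |∑' a, arrivalProb θ lam a * f a| ≤ C := by
  rw [← Real.norm_eq_abs]
  refine tsum_of_norm_bounded (g := fun a => arrivalProb θ lam a * C)
    (by simpa using (hasSum_arrivalProb θ lam).mul_right C) fun a => ?_
  rw [Real.norm_eq_abs, abs_mul, abs_of_nonneg (arrivalProb_nonneg _ _ _)]
  exact mul_le_mul_of_nonneg_left (hf a) (arrivalProb_nonneg _ _ _)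

theorem slotMean_add {x : State} {h h' : Outcome → ℕ → ℝ}
    (hs : ∀ z, Summable fun a => arrivalProb θ lam a * h z a)
    (hs' : ∀ z, Summable fun a => arrivalProb θ lam a * h' z a) :
    slotMean θ lam x (fun z a => h z a + h' z a) = slotMean θ lam x h + slotMean θ lam x h' := by
  simp only [slotMean, mul_add, (hs _).tsum_add (hs' _), Finset.sum_add_distrib]

theorem slotMean_sum {x : State} {h : ℕ → Outcome → ℕ → ℝ} (T : ℕ)
    (hs : ∀ t z, Summable fun a => arrivalProb θ lam a * h t z a) :
    slotMean θ lam x (fun z a => ∑ t ∈ Finset.range T, h t z a)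
      = ∑ t ∈ Finset.range T, slotMean θ lam x (h t) := by
  simp only [slotMean, Finset.mul_sum]
  rw [Finset.sum_comm]
  refine Finset.sum_congr rfl fun z _ => ?_
  rw [Summable.tsum_finsetSum fun t _ => hs t z, Finset.mul_sum]

/-- The mean of a function of the outcome and of `a`, affine in the number of arrivals. -/
theorem slotMean_affine (x : State) (s : ℝ) (u : Outcome → ℝ) :
    slotMean θ lam x (fun z a => s * a + u z)
      = s * (θ * lam) + ∑ z, outcomeProb x z * u z := by
  have h : ∀ z, ∑' a, arrivalProb θ lam a * (s * a + u z) = s * (θ * lam) + u z := fun z => by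
    have := ((hasSum_arrivalProb_mul_nat θ lam).mul_left s).add
      ((hasSum_arrivalProb θ lam).mul_right (u z))
    rw [one_mul] at this
    rw [← this.tsum_eq]
    exact tsum_congr fun a => by ring
  simp only [slotMean, h]
  simp only [mul_add, Finset.sum_add_distrib]
  rw [← Finset.sum_mul, sum_outcomeProb, one_mul]

end Mean

/-! ### The T-slot drift as a sum of expected increments -/

section Drift

variable (km : ℕ) (ν η : ℝ) (θ : unitInterval) (lam : ℝ≥0)

/-- Expected increment of `g` in the slot number `t` (from `0`) after the state `x`. -/
noncomputable def driftAt (g : State → ℝ) : ℕ → State → ℝ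
  | 0, x => slotMean θ lam x fun z a => g (nextState km ν η x a z) - g x
  | t + 1, x => slotMean θ lam x fun z a => driftAt g t (nextState km ν η x a z)

variable {km ν η θ lam}

theorem mu_nonneg {ν q : ℝ} (h0 : 0 ≤ q) (h1 : q ≤ 1) (km : ℕ) : 0 ≤ mu ν q km :=
  add_nonneg (Finset.sum_nonneg fun k _ => mul_nonneg (by positivity) (by linarith))
    (by positivity)

theorem q0_nonneg (ρ : ℝ) : 0 ≤ q0 ρ := (Real.exp_pos _).le

theorem q1_nonneg {ρ : ℝ} (h : 0 ≤ ρ) : 0 ≤ q1 ρ := mul_nonneg h (Real.exp_pos _).le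

theorem q0_le_one {ρ : ℝ} (h : 0 ≤ ρ) : q0 ρ ≤ 1 := by
  simpa [q0] using h

theorem qc_nonneg (ρ : ℝ) : 0 ≤ qc ρ := by
  have h := Real.add_one_le_exp ρ
  have e : Real.exp ρ * Real.exp (-ρ) = 1 := by rw [← Real.exp_add]; simp
  have := mul_le_mul_of_nonneg_right h (Real.exp_pos (-ρ)).le
  simp only [qc, q0, q1]
  linarith

theorem qc_le_one {ρ : ℝ} (h : 0 ≤ ρ) : qc ρ ≤ 1 := by
  have := q0_nonneg ρ
  have := q1_nonneg h
  simp only [qc]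
  linarith

theorem h0_nonneg (km : ℕ) (ν : ℝ) {η : ℝ} (hη : 0 ≤ η) : 0 ≤ h0 km ν η :=
  mul_nonneg hη (inv_nonneg.2 (mul_nonneg (q0_nonneg 1)
    (mu_nonneg (q0_nonneg 1) (q0_le_one zero_le_one) km)))

theorem hc_nonneg (km : ℕ) (ν : ℝ) {η : ℝ} (hη : 0 ≤ η) : 0 ≤ hc km ν η :=
  mul_nonneg hη (inv_nonneg.2 (mul_nonneg (qc_nonneg 1)
    (mu_nonneg (qc_nonneg 1) (qc_le_one zero_le_one) km)))

theorem exp_one_sub_two_pos : 0 < Real.exp 1 - 2 := by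
  have := Real.exp_one_gt_d9
  linarith

theorem one_le_inv_exp_one_sub_two : 1 ≤ (Real.exp 1 - 2)⁻¹ := by
  have := Real.exp_one_lt_d9
  exact (one_le_inv₀ exp_one_sub_two_pos).2 (by linarith)

/-- Truncation acts whatever the old memory was, so n̂ ≥ 1 is the only invariant that the drift
formulas need. -/
theorem abs_nextMemory_le (hkm : 1 < km) (k : ℤ) (z : Outcome) : |nextMemory km k z| ≤ km := by
  rcases z with _ | _ | _ <;> simp only [nextMemory]
  · split_ifs
    · rw [abs_neg, abs_of_nonneg (by positivity)]; exact min_le_right _ _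
    · simp; omega
  · simp
  · split_ifs with h
    · rw [abs_of_nonneg (by positivity)]; exact min_le_right _ _
    · simp; omega

theorem nextMemory_collision_pos (hkm : 1 < km) (k : ℤ) : 0 < nextMemory km k .collision := by
  simp only [nextMemory]
  split_ifs <;> omega

theorem one_le_estimate_nextState (hη : 0 ≤ η) (hkm : 1 < km) {x : State} (hx : 1 ≤ estimate x)
    (a : ℕ) (z : Outcome) : 1 ≤ estimate (nextState km ν η x a z) := by
  rcases z with _ | _ | _
  · exact le_max_left _ _
  · exact hx
  · have h1 : 0 ≤ 1 / (Real.exp 1 - 2) := one_div_nonneg.2 exp_one_sub_two_pos.le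
    have h2 : 0 ≤ hc km ν η * ((nextMemory km (memory x) .collision : ℤ) : ℝ) ^ ν :=
      mul_nonneg (hc_nonneg _ _ hη) (Real.rpow_nonneg
        (by exact_mod_cast (nextMemory_collision_pos hkm _).le) _)
    simp only [nextState, nextEstimate, estimate] at hx ⊢
    linarith

/-- A function of the state has increments controlled by the number of arrivals. -/
def IncrementBound (km : ℕ) (ν η : ℝ) (g : State → ℝ) (C : ℝ) : Prop :=
  ∀ x, 1 ≤ estimate x → ∀ a z, |g (nextState km ν η x a z) - g x| ≤ C * (1 + a)

theorem abs_driftAt_le (hη : 0 ≤ η) (hkm : 1 < km) {g : State → ℝ} {C : ℝ}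
    (hg : IncrementBound km ν η g C) (t : ℕ) :
    ∀ x, 1 ≤ estimate x → |driftAt km ν η θ lam g t x| ≤ C * (1 + θ * lam) := by
  induction t with
  | zero => exact fun x hx => abs_slotMean_le fun z a => hg x hx a z
  | succ t ih =>
    exact fun x hx => abs_sum_outcomeProb_mul_le fun z =>
      abs_tsum_arrivalProb_mul_le_of_bounded fun a => ih _ (one_le_estimate_nextState hη hkm hx a z)

theorem transition_succ (T : ℕ) (x : State) :
    transition km ν η θ lam (T + 1) x = (outcomeLaw (backlog x) (estimate x)).bind fun z =>
      (arrivalLaw θ lam).bind fun a => transition km ν η θ lam T (nextState km ν η x a z) := by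
  simp only [transition, step, PMF.bind_bind, PMF.bind_map]
  rfl

/-- Induction on T, splitting g y - g x at the state x' after the first slot. The absolute moment
bound is carried along because the exchange of sums at the next step requires it. -/
theorem hasSum_transition (hη : 0 ≤ η) (hkm : 1 < km) {g : State → ℝ} {C : ℝ}
    (hg : IncrementBound km ν η g C) (T : ℕ) : ∀ x, 1 ≤ estimate x →
    HasSum (fun y => (transition km ν η θ lam T x y).toReal * (g y - g x))
        (∑ t ∈ Finset.range T, driftAt km ν η θ lam g t x) ∧
      ∑' y, (transition km ν η θ lam T x y).toReal * |g y - g x| ≤ T * (C * (1 + θ * lam)) := by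
  induction T with
  | zero =>
    intro x _
    have e : ∀ y, ((transition km ν η θ lam 0 x) y).toReal * (g y - g x) = 0 := fun y => by
      rcases eq_or_ne y x with rfl | h <;> simp [transition, *]
    have e' : ∀ y, ((transition km ν η θ lam 0 x) y).toReal * |g y - g x| = 0 := fun y => by
      rcases eq_or_ne y x with rfl | h <;> simp [transition, *]
    simp [e, e', hasSum_zero]
  | succ T ih =>
    intro x hx
    set B := C * (1 + (θ : ℝ) * lam) with hB
    have hnext := fun a z => one_le_estimate_nextState (ν := ν) hη hkm hx a z
    have hsum1 : ∀ t z, Summable fun a => arrivalProb θ lam a *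
        driftAt km ν η θ lam g t (nextState km ν η x a z) := fun t z =>
      summable_arrivalProb_mul (C := B) fun a => by
        have h1 := abs_driftAt_le (θ := θ) (lam := lam) hη hkm hg t _ (hnext a z)
        have h2 : 0 ≤ B := (abs_nonneg _).trans h1
        exact h1.trans (le_mul_of_one_le_right h2 (by simp))
    have hsum2 : ∀ z, Summable fun a => arrivalProb θ lam a *
        (g (nextState km ν η x a z) - g x) := fun z =>
      summable_arrivalProb_mul fun a => hg x hx a z
    have hb : HasSum (fun a => arrivalProb θ lam a * (T * B + C * (1 + a)))
        ((T + 1 : ℕ) * B) := by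
      have := ((hasSum_arrivalProb θ lam).mul_right (T * B + C)).add
        ((hasSum_arrivalProb_mul_nat θ lam).mul_left C)
      have e : ((T + 1 : ℕ) : ℝ) * B = 1 * (T * B + C) + C * (θ * lam) := by
        push_cast
        rw [hB]
        ring
      rw [e]
      exact this.congr_fun fun a => by ring
    have inner : ∀ z,
        HasSum (fun y => (((arrivalLaw θ lam).bind fun a =>
            transition km ν η θ lam T (nextState km ν η x a z)) y).toReal * (g y - g x))
          (∑' a, arrivalProb θ lam a * (∑ t ∈ Finset.range T, driftAt km ν η θ lam g t
            (nextState km ν η x a z) + (g (nextState km ν η x a z) - g x))) ∧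
        ∑' y, (((arrivalLaw θ lam).bind fun a =>
            transition km ν η θ lam T (nextState km ν η x a z)) y).toReal * |g y - g x|
          ≤ (T + 1 : ℕ) * B := by
      intro z
      rw [← hb.tsum_eq]
      refine PMF.hasSum_bind (fun a => ?_) (fun a => ?_) hb.summable
      · have := (ih _ (hnext a z)).1.add ((transition km ν η θ lam T
          (nextState km ν η x a z)).hasSum_toReal.mul_right (g (nextState km ν η x a z) - g x))
        rw [one_mul] at this
        convert this using 1
        ext y; ring
      · set x' := nextState km ν η x a z with hx'
        have h1 := ih _ (hnext a z)
        have h2 := (transition km ν η θ lam T x').hasSum_toReal.mul_right |g x' - g x|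
        have h3 : Summable fun y => (transition km ν η θ lam T x' y).toReal * |g y - g x'| := by
          have := h1.1.summable.abs
          simpa only [abs_mul, abs_of_nonneg ENNReal.toReal_nonneg] using this
        have hle : ∀ y, (transition km ν η θ lam T x' y).toReal * |g y - g x|
            ≤ (transition km ν η θ lam T x' y).toReal * |g y - g x'|
              + (transition km ν η θ lam T x' y).toReal * |g x' - g x| := fun y => by
          rw [← mul_add]
          exact mul_le_mul_of_nonneg_left (abs_sub_le _ _ _) ENNReal.toReal_nonneg
        have h4 := (h3.add h2.summable).of_nonneg_of_le
          (fun y => mul_nonneg ENNReal.toReal_nonneg (abs_nonneg _)) hle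
        have h5 := h4.tsum_le_tsum hle (h3.add h2.summable)
        rw [h3.tsum_add h2.summable, h2.tsum_eq, one_mul] at h5
        exact h5.trans (add_le_add h1.2 (hg x hx a z))
    have hs : HasSum (fun z => (outcomeLaw (backlog x) (estimate x) z).toReal
        * ((T + 1 : ℕ) * B)) ((T + 1 : ℕ) * B) := by
      simpa using (outcomeLaw (backlog x) (estimate x)).hasSum_toReal.mul_right ((T + 1 : ℕ) * B)
    have h := PMF.hasSum_bind (fun z => (inner z).1) (fun z => (inner z).2) hs.summable
    rw [hs.tsum_eq, ← transition_succ, tsum_fintype] at h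
    refine ⟨?_, h.2⟩
    have e := slotMean_add (x := x) (θ := θ) (lam := lam)
      (h := fun z a => ∑ t ∈ Finset.range T, driftAt km ν η θ lam g t (nextState km ν η x a z))
      (h' := fun z a => g (nextState km ν η x a z) - g x)
      (fun z => by
        simp only [Finset.mul_sum]
        exact summable_sum fun t _ => hsum1 t z) hsum2
    rw [slotMean_sum T hsum1] at e
    rw [Finset.sum_range_succ']
    exact e ▸ h.1

/-- The mean increment of `g` over `T` slots is the sum of its expected increments. -/
theorem integral_transition (hη : 0 ≤ η) (hkm : 1 < km) {g : State → ℝ} {C : ℝ}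
    (hg : IncrementBound km ν η g C) (T : ℕ) {x : State} (hx : 1 ≤ estimate x) :
    ∫ y, (g y - g x) ∂(transition km ν η θ lam T x).toMeasure
      = ∑ t ∈ Finset.range T, driftAt km ν η θ lam g t x := by
  rw [PMF.integral_toMeasure_eq_tsum]
  exact (hasSum_transition hη hkm hg T x hx).1.tsum_eq

end Drift

open Filter Topology

/-! ### Binomial formulas for the outcomes -/

section OutcomeProb

theorem txProb_coe {nhat : ℝ} (h : 1 ≤ nhat) : (txProb nhat : ℝ) = 1 / nhat := by
  rw [txProb, Set.projIcc_of_mem _ ⟨by positivity, (div_le_one (by linarith)).2 h⟩]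

theorem outcomeProb_idle {x : State} (h : 1 ≤ estimate x) :
    outcomeProb x .idle = (1 - 1 / estimate x) ^ backlog x := by
  have e : outcomeLaw (backlog x) (estimate x) .idle
      = ProbabilityTheory.binomial (backlog x) (txProb (estimate x)) {0} := by
    rw [outcomeLaw, PMF.map_apply, tsum_eq_single 0]
    · simp [outcomeOf, MeasureTheory.Measure.toPMF_apply]
    · rintro (_ | _ | m) hm <;> simp_all [outcomeOf]
  rw [outcomeProb, e, ← txProb_coe h]
  exact ProbabilityTheory.binomial_real_zero _ _

theorem outcomeProb_success {x : State} (h : 1 ≤ estimate x) :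
    outcomeProb x .success
      = backlog x * (1 / estimate x) * (1 - 1 / estimate x) ^ (backlog x - 1) := by
  have e : outcomeLaw (backlog x) (estimate x) .success
      = ProbabilityTheory.binomial (backlog x) (txProb (estimate x)) {1} := by
    rw [outcomeLaw, PMF.map_apply, tsum_eq_single 1]
    · simp [outcomeOf, MeasureTheory.Measure.toPMF_apply]
    · rintro (_ | _ | m) hm <;> simp_all [outcomeOf]
  rw [outcomeProb, e, ← txProb_coe h]
  refine (ProbabilityTheory.binomial_real_singleton (backlog x) 1 (txProb (estimate x))).trans ?_
  simp

theorem outcomeProb_collision (x : State) :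
    outcomeProb x .collision = 1 - outcomeProb x .idle - outcomeProb x .success := by
  have := sum_outcomeProb x
  rw [sum_outcome] at this
  linarith

end OutcomeProb

/-! ### Bounded increments and one-slot drifts -/

section Increment

variable {km : ℕ} {ν η : ℝ} {θ : unitInterval} {lam : ℝ≥0}

/-- The number of packets that leave in a slot with outcome `z` and nonempty backlog. -/
def departures : Outcome → ℝ
  | .success => 1
  | _ => 0

/-- The estimate error `n̂ - n`. -/
def errorOf (x : State) : ℝ := estimate x - backlog x

/-- Increment of the estimate in a slot with outcome `z`. -/
noncomputable def estimateIncrement (km : ℕ) (ν η : ℝ) (x : State) (z : Outcome) : ℝ :=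
  nextEstimate km ν η (estimate x) (nextMemory km (memory x) z) z - estimate x

/-- A bound for the change of the estimate in a slot. -/
noncomputable def estimateBound (km : ℕ) (ν η : ℝ) : ℝ :=
  1 + h0 km ν η * (km : ℝ) ^ ν + ((Real.exp 1 - 2)⁻¹ + hc km ν η * (km : ℝ) ^ ν)

theorem estimateBound_nonneg (hη : 0 ≤ η) : 0 ≤ estimateBound km ν η := by
  have := h0_nonneg km ν hη
  have := hc_nonneg km ν hη
  have := inv_nonneg.2 exp_one_sub_two_pos.le
  unfold estimateBound
  positivity

/-- Since n̂ ≥ 1 already, the floor at 1 can only shorten a decrease. -/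
theorem abs_estimateIncrement_le (hkm : 1 < km) (hν : 0 ≤ ν) (hη : 0 ≤ η) {x : State}
    (hx : 1 ≤ estimate x) (z : Outcome) :
    |estimateIncrement km ν η x z| ≤ estimateBound km ν η := by
  have a0 := h0_nonneg km ν hη
  have ac := hc_nonneg km ν hη
  have ae := inv_nonneg.2 exp_one_sub_two_pos.le
  have apow : 0 ≤ (km : ℝ) ^ ν := by positivity
  have hpow : ∀ z, |(nextMemory km (memory x) z : ℝ)| ^ ν ≤ (km : ℝ) ^ ν := fun z =>
    Real.rpow_le_rpow (abs_nonneg _) (by exact_mod_cast abs_nextMemory_le hkm _ _) hν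
  have b0 := mul_nonneg a0 apow
  have bc := mul_nonneg ac apow
  rcases z with _ | _ | _
  · have h1 := mul_le_mul_of_nonneg_left (hpow .idle) a0
    have h2 := mul_nonneg a0 (Real.rpow_nonneg (abs_nonneg
      (nextMemory km (memory x) .idle : ℝ)) ν)
    simp only [estimateIncrement, nextEstimate, estimateBound]
    rw [abs_le]
    constructor
    · have := le_max_right 1
        (estimate x - 1 - h0 km ν η * |(nextMemory km (memory x) .idle : ℝ)| ^ ν)
      linarith
    · rw [sub_le_iff_le_add]
      exact max_le (by linarith) (by linarith)
  · simpa [estimateIncrement, nextEstimate] using estimateBound_nonneg hη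
  · have h3 : (0 : ℝ) ≤ nextMemory km (memory x) .collision := by
      exact_mod_cast (nextMemory_collision_pos hkm _).le
    have h1 := mul_le_mul_of_nonneg_left (hpow .collision) ac
    rw [abs_of_nonneg h3] at h1
    have h2 := mul_nonneg ac (Real.rpow_nonneg h3 ν)
    simp only [estimateIncrement, nextEstimate, estimateBound, one_div]
    rw [abs_le]
    constructor <;> linarith

theorem abs_backlog_nextState_sub_le (x : State) (a : ℕ) (z : Outcome) :
    |(backlog (nextState km ν η x a z) : ℝ) - backlog x| ≤ 1 + a := by
  have h1 : backlog (nextState km ν η x a z) ≤ backlog x + a := by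
    rcases z with _ | _ | _ <;> simp only [nextState, nextBacklog, backlog] <;> omega
  have h2 : backlog x ≤ backlog (nextState km ν η x a z) + 1 := by
    rcases z with _ | _ | _ <;> simp only [nextState, nextBacklog, backlog] <;> omega
  have h1' : (backlog (nextState km ν η x a z) : ℝ) ≤ backlog x + a := by exact_mod_cast h1
  have h2' : (backlog x : ℝ) ≤ backlog (nextState km ν η x a z) + 1 := by exact_mod_cast h2
  have h3 : (0 : ℝ) ≤ a := a.cast_nonneg
  rw [abs_le]
  constructor <;> linarith

theorem incrementBound_backlog : IncrementBound km ν η (fun x => (backlog x : ℝ)) 1 :=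
  fun x _ a z => by simpa using abs_backlog_nextState_sub_le x a z

theorem incrementBound_errorOf (hkm : 1 < km) (hν : 0 ≤ ν) (hη : 0 ≤ η) :
    IncrementBound km ν η errorOf (1 + estimateBound km ν η) := fun x hx a z => by
  have h1 := abs_backlog_nextState_sub_le (km := km) (ν := ν) (η := η) x a z
  have h2 := abs_estimateIncrement_le hkm hν hη hx z
  have h3 : (0 : ℝ) ≤ a := a.cast_nonneg
  have h4 := mul_nonneg (estimateBound_nonneg (km := km) (ν := ν) hη) h3
  have e : errorOf (nextState km ν η x a z) - errorOf x
      = estimateIncrement km ν η x z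
        - ((backlog (nextState km ν η x a z) : ℝ) - backlog x) := by
    simp only [errorOf, estimateIncrement, nextState, estimate]
    ring
  rw [e]
  calc _ ≤ _ := abs_sub _ _
    _ ≤ estimateBound km ν η + (1 + a) := add_le_add h2 h1
    _ ≤ _ := by linarith

/-- Ignoring null outcomes matters for a success with empty backlog: there the truncated subtraction
could differ from n + a - 1, but the probability is 0. -/
theorem slotMean_congr {x : State} {h h' : Outcome → ℕ → ℝ}
    (e : ∀ z, outcomeProb x z ≠ 0 → ∀ a, h z a = h' z a) :
    slotMean θ lam x h = slotMean θ lam x h' := by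
  refine Finset.sum_congr rfl fun z _ => ?_
  by_cases hz : outcomeProb x z = 0
  · simp [hz]
  · simp only [e z hz]

/-- The truncation of the backlog at `0` is not effective with positive probability. -/
theorem backlog_nextState {x : State} (hx : 1 ≤ estimate x) {z : Outcome}
    (hz : outcomeProb x z ≠ 0) (a : ℕ) :
    (backlog (nextState km ν η x a z) : ℝ)
      = backlog x + a - departures z := by
  rcases z with _ | _ | _
  · simp [nextState, nextBacklog, backlog, departures]
  · have hn : 1 ≤ backlog x + a := by
      rcases Nat.eq_zero_or_pos (backlog x) with h | h
      · exact absurd (by rw [outcomeProb_success hx, h]; simp) hz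
      · omega
    change ((backlog x + a - 1 : ℕ) : ℝ) = _
    rw [Nat.cast_sub hn]
    simp [departures]
  · simp [nextState, nextBacklog, backlog, departures]

theorem driftAt_backlog_zero {x : State} (hx : 1 ≤ estimate x) :
    driftAt km ν η θ lam (fun x => (backlog x : ℝ)) 0 x
      = θ * lam - outcomeProb x .success := by
  have h := slotMean_affine (θ := θ) (lam := lam) x 1
    (fun z => -departures z)
  have e1 : departures .idle = 0 := rfl
  have e2 : departures .success = 1 := rfl
  have e3 : departures .collision = 0 := rfl
  rw [sum_outcome, e1, e2, e3] at h
  rw [driftAt, slotMean_congr fun z hz a => ?_, h]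
  · ring
  · rw [backlog_nextState hx hz]
    ring

theorem driftAt_errorOf_zero {x : State} (hx : 1 ≤ estimate x) :
    driftAt km ν η θ lam errorOf 0 x = -(θ * lam) + outcomeProb x .success
      + (outcomeProb x .idle * estimateIncrement km ν η x .idle
        + outcomeProb x .collision * estimateIncrement km ν η x .collision) := by
  have h := slotMean_affine (θ := θ) (lam := lam) x (-1)
    (fun z => departures z + estimateIncrement km ν η x z)
  have e : estimateIncrement km ν η x .success = 0 := by simp [estimateIncrement, nextEstimate]
  have e1 : departures .idle = 0 := rfl
  have e2 : departures .success = 1 := rfl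
  have e3 : departures .collision = 0 := rfl
  rw [sum_outcome, e, e1, e2, e3] at h
  rw [driftAt, slotMean_congr fun z hz a => ?_, h]
  · ring
  · simp only [errorOf]
    rw [backlog_nextState hx hz]
    simp only [estimateIncrement, nextState, estimate]
    ring

end Increment

/-! ### Limits of outcomes and drifts along large states -/

section Limits

variable {ι : Type*} {l : Filter ι}

/-- Along `l` the estimate tends to infinity, the load `n / n̂` tends to `r`, and the memory is
eventually `k`. -/
structure FiniteLoad (l : Filter ι) (r : ℝ) (X : ι → State) (k : ℤ) : Prop where
  one_le : ∀ j, 1 ≤ estimate (X j)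
  tendsto_estimate : Tendsto (fun j => estimate (X j)) l atTop
  tendsto_load : Tendsto (fun j => (backlog (X j) : ℝ) / estimate (X j)) l (𝓝 r)
  memory_eq : ∀ᶠ j in l, memory (X j) = k

/-- Along `l` the load `n / n̂` tends to infinity, and the memory is eventually `k`. -/
structure Overload (l : Filter ι) (X : ι → State) (k : ℤ) : Prop where
  one_le : ∀ j, 1 ≤ estimate (X j)
  tendsto_load : Tendsto (fun j => (backlog (X j) : ℝ) / estimate (X j)) l atTop
  memory_eq : ∀ᶠ j in l, memory (X j) = k

/-- Outcome probabilities for a Poisson number of packets with mean `r`. -/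
noncomputable def poissonOutcome (r : ℝ) : Outcome → ℝ
  | .idle => q0 r
  | .success => q1 r
  | .collision => qc r

/-- Outcome probabilities in the limit of infinite load. -/
def overloadOutcome : Outcome → ℝ
  | .collision => 1
  | _ => 0

/-- Poisson limit: n log(1 - 1/n̂) = (n/n̂) · n̂ log(1 - 1/n̂) tends to -r, and the success
probability is the idle one times (n/n̂) / (1 - 1/n̂). -/
theorem FiniteLoad.tendsto_outcomeProb {r : ℝ} {X : ι → State} {k : ℤ} (h : FiniteLoad l r X k)
    (z : Outcome) : Tendsto (fun j => outcomeProb (X j) z) l (𝓝 (poissonOutcome r z)) := by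
  have h1 : ∀ᶠ j in l, 1 < estimate (X j) := h.tendsto_estimate.eventually_gt_atTop 1
  have idle : Tendsto (fun j => outcomeProb (X j) .idle) l (𝓝 (q0 r)) := by
    have t := (Real.tendsto_mul_log_one_add_div_atTop (-1)).comp h.tendsto_estimate
    have t2 := (Real.continuous_exp.tendsto _).comp (h.tendsto_load.mul t)
    rw [mul_neg_one] at t2
    refine t2.congr' ?_
    filter_upwards [h1] with j hj
    have hpos : 0 < 1 - 1 / estimate (X j) := by
      rw [sub_pos, div_lt_one (by linarith)]; exact hj
    have hne : estimate (X j) ≠ 0 := by linarith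
    rw [outcomeProb_idle hj.le]
    simp only [Function.comp_apply]
    rw [← Real.rpow_natCast, Real.rpow_def_of_pos hpos]
    have e : 1 + -1 / estimate (X j) = 1 - 1 / estimate (X j) := by ring
    rw [e]
    congr 1
    field_simp
  have success : Tendsto (fun j => outcomeProb (X j) .success) l (𝓝 (q1 r)) := by
    have t0 : Tendsto (fun j => 1 - 1 / estimate (X j)) l (𝓝 (1 - 0)) :=
      tendsto_const_nhds.sub (tendsto_const_nhds.div_atTop h.tendsto_estimate)
    have t := (h.tendsto_load.mul idle).div t0 (by norm_num)
    rw [sub_zero, div_one] at t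
    refine t.congr' ?_
    filter_upwards [h1] with j hj
    have hpos : 0 < 1 - 1 / estimate (X j) := by
      rw [sub_pos, div_lt_one (by linarith)]; exact hj
    rw [outcomeProb_success hj.le]
    simp only [Pi.div_apply]
    rw [outcomeProb_idle hj.le]
    -- The exponent n - 1 is truncated at n = 0, where the factor n annihilates both sides.
    rcases Nat.eq_zero_or_pos (backlog (X j)) with h0 | h0
    · simp [h0]
    · obtain ⟨m, hm⟩ := Nat.exists_eq_succ_of_ne_zero h0.ne'
      rw [hm, Nat.succ_sub_one, pow_succ, ← mul_assoc, mul_div_cancel_right₀ _ hpos.ne',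
        mul_one_div]
  rcases z with _ | _ | _
  · exact idle
  · exact success
  · simp only [outcomeProb_collision]
    exact (tendsto_const_nhds.sub idle).sub success

/-- From 1 - x ≤ e^{-x}, idle has probability at most e^{-ρ} and success at most ρ e^{1-ρ}; the
factor e pays for the exponent n - 1. The estimate need not tend to infinity. -/
theorem Overload.tendsto_outcomeProb {X : ι → State} {k : ℤ} (h : Overload l X k)
    (z : Outcome) : Tendsto (fun j => outcomeProb (X j) z) l (𝓝 (overloadOutcome z)) := by
  have hp : ∀ j, 0 ≤ 1 - 1 / estimate (X j) := fun j => by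
    rw [sub_nonneg, div_le_one (by linarith [h.one_le j])]; exact h.one_le j
  have hexp : ∀ j, 1 - 1 / estimate (X j) ≤ Real.exp (-(1 / estimate (X j))) :=
    fun j => Real.one_sub_le_exp_neg _
  have idle : Tendsto (fun j => outcomeProb (X j) .idle) l (𝓝 0) := by
    refine squeeze_zero (fun j => outcomeProb_nonneg _ _) (fun j => ?_)
      (Real.tendsto_exp_neg_atTop_nhds_zero.comp h.tendsto_load)
    rw [outcomeProb_idle (h.one_le j)]
    refine (pow_le_pow_left₀ (hp j) (hexp j) _).trans_eq ?_
    rw [← Real.exp_nat_mul]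
    simp only [Function.comp_apply]
    congr 1
    ring
  have success : Tendsto (fun j => outcomeProb (X j) .success) l (𝓝 0) := by
    have t := ((Real.tendsto_pow_mul_exp_neg_atTop_nhds_zero 1).comp h.tendsto_load).mul_const (Real.exp 1)
    rw [zero_mul] at t
    refine squeeze_zero (fun j => outcomeProb_nonneg _ _) (fun j => ?_) t
    rw [outcomeProb_success (h.one_le j)]
    simp only [Function.comp_apply, pow_one]
    rw [mul_one_div, mul_assoc, ← Real.exp_add]
    have hinv : 1 / estimate (X j) ≤ 1 := by linarith [hp j]
    have hest : 0 < estimate (X j) := by linarith [h.one_le j]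
    refine mul_le_mul_of_nonneg_left ?_ (by positivity)
    refine (pow_le_pow_left₀ (hp j) (hexp j) _).trans ?_
    rw [← Real.exp_nat_mul]
    refine Real.exp_le_exp.2 ?_
    have hc : (backlog (X j) : ℝ) - 1 ≤ ((backlog (X j) - 1 : ℕ) : ℝ) := by
      rw [sub_le_iff_le_add]
      exact_mod_cast (by omega : backlog (X j) ≤ backlog (X j) - 1 + 1)
    have := mul_le_mul_of_nonneg_right hc (one_div_nonneg.2 hest.le)
    rw [sub_mul, mul_one_div] at this
    linarith
  rcases z with _ | _ | _
  · exact idle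
  · exact success
  · simp only [outcomeProb_collision]
    simpa [overloadOutcome] using (tendsto_const_nhds (x := (1 : ℝ))).sub idle |>.sub success

variable {km : ℕ} {ν η : ℝ} {θ : unitInterval} {lam : ℝ≥0}

theorem estimate_nextState (x : State) (a : ℕ) (z : Outcome) :
    estimate (nextState km ν η x a z) = estimate x + estimateIncrement km ν η x z := by
  simp only [estimateIncrement, nextState, estimate]
  ring

/-- For fixed arrivals both n and n̂ move by bounded amounts, negligible against n̂ → ∞. -/
theorem FiniteLoad.next (hkm : 1 < km) (hν : 0 ≤ ν) (hη : 0 ≤ η) {r : ℝ} {X : ι → State}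
    {k : ℤ} (h : FiniteLoad l r X k) (a : ℕ) (z : Outcome) :
    FiniteLoad l r (fun j => nextState km ν η (X j) a z) (nextMemory km k z) where
  one_le j := one_le_estimate_nextState hη hkm (h.one_le j) a z
  tendsto_estimate := by
    refine tendsto_atTop_mono (fun j => ?_)
      (tendsto_atTop_add_const_right l (-estimateBound km ν η) h.tendsto_estimate)
    rw [estimate_nextState]
    have := (abs_le.1 (abs_estimateIncrement_le hkm hν hη (h.one_le j) z)).1
    linarith
  tendsto_load := by
    have hinv : ∀ C : ℝ, Tendsto (fun j => C / estimate (X j)) l (𝓝 0) := fun C =>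
      tendsto_const_nhds.div_atTop h.tendsto_estimate
    have hsmall : ∀ (w : ι → ℝ) (C : ℝ), (∀ j, |w j| ≤ C) →
        Tendsto (fun j => w j / estimate (X j)) l (𝓝 0) := fun w C hw =>
      squeeze_zero_norm (fun j => by
        have := h.one_le j
        rw [Real.norm_eq_abs, abs_div, abs_of_nonneg (by linarith : 0 ≤ estimate (X j))]
        exact div_le_div_of_nonneg_right (hw j) (by linarith)) (hinv C)
    have t1 := h.tendsto_load.add (hsmall _ _
      fun j => abs_backlog_nextState_sub_le (km := km) (ν := ν) (η := η) (X j) a z)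
    have t2 := (tendsto_const_nhds (x := (1 : ℝ))).add
      (hsmall _ _ fun j => abs_estimateIncrement_le hkm hν hη (h.one_le j) z)
    have t := t1.div t2 (by norm_num)
    rw [add_zero, add_zero, div_one] at t
    refine t.congr fun j => ?_
    have hne : estimate (X j) ≠ 0 := by linarith [h.one_le j]
    simp only [Pi.div_apply]
    rw [estimate_nextState, ← add_div, one_add_div hne, div_div_div_cancel_right₀ hne]
    congr 1
    ring
  memory_eq := h.memory_eq.mono fun j hj => by
    simp only [nextState, memory] at hj ⊢
    rw [hj]

/-- Here n̂ may stay bounded, so increments are not negligible. But n loses at most 1, and n̂ + D ≤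
n̂(1 + D) because n̂ ≥ 1, so the load shrinks by at most a constant factor after losing at most 1.
-/
theorem Overload.next (hkm : 1 < km) (hν : 0 ≤ ν) (hη : 0 ≤ η) {X : ι → State}
    {k : ℤ} (h : Overload l X k) (a : ℕ) (z : Outcome) :
    Overload l (fun j => nextState km ν η (X j) a z) (nextMemory km k z) where
  one_le j := one_le_estimate_nextState hη hkm (h.one_le j) a z
  tendsto_load := by
    set D := estimateBound km ν η with hD
    have hD0 : 0 ≤ D := estimateBound_nonneg hη
    refine tendsto_atTop_mono (fun j => ?_)
      ((tendsto_atTop_add_const_right l (-1) h.tendsto_load).atTop_div_const (by linarith : 0 < 1 + D))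
    have hx := h.one_le j
    have hx' := one_le_estimate_nextState (ν := ν) hη hkm hx a z
    have hle : estimate (nextState km ν η (X j) a z) ≤ estimate (X j) * (1 + D) := by
      rw [estimate_nextState]
      have := (abs_le.1 (abs_estimateIncrement_le hkm hν hη hx z)).2
      nlinarith
    have hb : (backlog (X j) : ℝ) - 1 ≤ backlog (nextState km ν η (X j) a z) := by
      have : backlog (X j) ≤ backlog (nextState km ν η (X j) a z) + 1 := by
        rcases z with _ | _ | _ <;> simp only [nextState, nextBacklog, backlog] <;> omega
      rw [sub_le_iff_le_add]
      exact_mod_cast this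
    calc ((backlog (X j) : ℝ) / estimate (X j) + -1) / (1 + D)
        ≤ (backlog (nextState km ν η (X j) a z) / estimate (X j)) / (1 + D) := by
          refine div_le_div_of_nonneg_right ?_ (by linarith)
          have h1 := div_le_div_of_nonneg_right hb (by linarith : 0 ≤ estimate (X j))
          have h2 : 1 / estimate (X j) ≤ 1 := (div_le_one (by linarith)).2 hx
          rw [sub_div] at h1
          linarith
      _ = backlog (nextState km ν η (X j) a z) / (estimate (X j) * (1 + D)) := by
          rw [div_div]
      _ ≤ _ := div_le_div_of_nonneg_left (Nat.cast_nonneg _) (by linarith) hle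
  memory_eq := h.memory_eq.mono fun j hj => by
    simp only [nextState, memory] at hj ⊢
    rw [hj]

/-- Mean of `e` along the memory chain driven by independent outcomes with law `p`. -/
noncomputable def memoryMean (km : ℕ) (p : Outcome → ℝ) (e : ℤ → ℝ) : ℕ → ℤ → ℝ
  | 0, k => e k
  | t + 1, k => ∑ z, p z * memoryMean km p e t (nextMemory km k z)

/-- The regime `S` is preserved by each fixed pair of arrivals and outcome, so induction on the slot
number reduces to the first slot. The sum over arrivals passes to the limit by dominated
convergence, with the uniform bound of `abs_driftAt_le`. -/
theorem tendsto_driftAt (hkm : 1 < km) (hη : 0 ≤ η) {g : State → ℝ} {C : ℝ}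
    (hg : IncrementBound km ν η g C) {p : Outcome → ℝ} {e : ℤ → ℝ}
    {S : (ι → State) → ℤ → Prop}
    (hS : ∀ X k, S X k → ∀ a z, S (fun j => nextState km ν η (X j) a z) (nextMemory km k z))
    (hest : ∀ X k, S X k → ∀ j, 1 ≤ estimate (X j))
    (hp : ∀ X k, S X k → ∀ z, Tendsto (fun j => outcomeProb (X j) z) l (𝓝 (p z)))
    (h0 : ∀ X k, S X k → Tendsto (fun j => driftAt km ν η θ lam g 0 (X j)) l (𝓝 (e k)))
    (t : ℕ) : ∀ X k, S X k →
      Tendsto (fun j => driftAt km ν η θ lam g t (X j)) l (𝓝 (memoryMean km p e t k)) := by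
  induction t with
  | zero => exact h0
  | succ t ih =>
    intro X k hX
    simp only [driftAt, slotMean, memoryMean]
    refine tendsto_finsetSum _ fun z _ => (hp X k hX z).mul ?_
    have ha : ∑' a, arrivalProb θ lam a * memoryMean km p e t (nextMemory km k z)
        = memoryMean km p e t (nextMemory km k z) := by
      rw [tsum_mul_right, (hasSum_arrivalProb θ lam).tsum_eq, one_mul]
    rw [← ha]
    refine tendsto_tsum_of_dominated_convergence
      (bound := fun a => arrivalProb θ lam a * (C * (1 + θ * lam)))
      ((hasSum_arrivalProb θ lam).summable.mul_right _)
      (fun a => (ih _ _ (hS X k hX a z)).const_mul _) (Eventually.of_forall fun j a => ?_)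
    rw [Real.norm_eq_abs, abs_mul, abs_of_nonneg (arrivalProb_nonneg _ _ _)]
    exact mul_le_mul_of_nonneg_left
      (abs_driftAt_le hη hkm hg t _ (hest _ _ (hS X k hX a z) j)) (arrivalProb_nonneg _ _ _)

theorem abs_memoryMean_le [l.NeBot] {g : State → ℝ} {C : ℝ} (hkm : 1 < km) (hη : 0 ≤ η)
    (hg : IncrementBound km ν η g C) {X : ι → State} (hX : ∀ j, 1 ≤ estimate (X j)) {t : ℕ}
    {m : ℝ} (h : Tendsto (fun j => driftAt km ν η θ lam g t (X j)) l (𝓝 m)) :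
    |m| ≤ C * (1 + θ * lam) :=
  le_of_tendsto h.abs (Eventually.of_forall fun j => abs_driftAt_le hη hkm hg t _ (hX j))

/-- Limit of the one-slot drift of the estimate error: here the truncation of the estimate at `1`
has disappeared. -/
noncomputable def errorRate (km : ℕ) (ν η lbar : ℝ) (p : Outcome → ℝ) (k : ℤ) : ℝ :=
  -lbar + p .success
    + (p .idle * (-1 - h0 km ν η * |(nextMemory km k .idle : ℝ)| ^ ν)
      + p .collision * ((Real.exp 1 - 2)⁻¹
        + hc km ν η * (nextMemory km k .collision : ℝ) ^ ν))

theorem tendsto_collisionIncrement {X : ι → State} {k : ℤ}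
    (h : ∀ᶠ j in l, memory (X j) = k) :
    Tendsto (fun j => estimateIncrement km ν η (X j) .collision) l
      (𝓝 ((Real.exp 1 - 2)⁻¹ + hc km ν η * (nextMemory km k .collision : ℝ) ^ ν)) := by
  refine tendsto_const_nhds.congr' ?_
  filter_upwards [h] with j hj
  simp only [estimateIncrement, nextEstimate]
  rw [hj]
  ring

theorem FiniteLoad.tendsto_driftAt_errorOf_zero {r : ℝ} {X : ι → State} {k : ℤ}
    (h : FiniteLoad l r X k) :
    Tendsto (fun j => driftAt km ν η θ lam errorOf 0 (X j)) l
      (𝓝 (errorRate km ν η (θ * lam) (poissonOutcome r) k)) := by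
  simp only [fun j => driftAt_errorOf_zero (km := km) (ν := ν) (η := η) (θ := θ) (lam := lam)
    (h.one_le j)]
  refine (tendsto_const_nhds.add (h.tendsto_outcomeProb _)).add
    (((h.tendsto_outcomeProb _).mul ?_).add
      ((h.tendsto_outcomeProb _).mul (tendsto_collisionIncrement h.memory_eq)))
  refine tendsto_const_nhds.congr' ?_
  -- Above this level an idle slot leaves the estimate at least 1, so the floor is inactive.
  filter_upwards [h.memory_eq, h.tendsto_estimate.eventually_ge_atTop
    (2 + h0 km ν η * |(nextMemory km k .idle : ℝ)| ^ ν)] with j hj hj'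
  simp only [estimateIncrement, nextEstimate]
  rw [hj, max_eq_right (by linarith)]
  ring

/-- The floor may be active here, but the idle increment is bounded and its probability tends to 0.
-/
theorem Overload.tendsto_driftAt_errorOf_zero (hkm : 1 < km) (hν : 0 ≤ ν) (hη : 0 ≤ η)
    {X : ι → State} {k : ℤ} (h : Overload l X k) :
    Tendsto (fun j => driftAt km ν η θ lam errorOf 0 (X j)) l
      (𝓝 (errorRate km ν η (θ * lam) overloadOutcome k)) := by
  simp only [fun j => driftAt_errorOf_zero (km := km) (ν := ν) (η := η) (θ := θ) (lam := lam)
    (h.one_le j)]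
  refine (tendsto_const_nhds.add (h.tendsto_outcomeProb _)).add (Tendsto.add ?_
      ((h.tendsto_outcomeProb _).mul (tendsto_collisionIncrement h.memory_eq)))
  simp only [overloadOutcome, zero_mul]
  refine squeeze_zero_norm (a := fun j => outcomeProb (X j) .idle * estimateBound km ν η)
    (fun j => ?_) ?_
  · rw [Real.norm_eq_abs, abs_mul, abs_of_nonneg (outcomeProb_nonneg _ _)]
    exact mul_le_mul_of_nonneg_left (abs_estimateIncrement_le hkm hν hη (h.one_le j) _)
      (outcomeProb_nonneg _ _)
  · simpa [overloadOutcome] using (h.tendsto_outcomeProb .idle).mul_const (estimateBound km ν η)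

end Limits

/-! ### Run lengths and the memory chain -/

section RunLength

variable {km : ℕ} {ν η lbar : ℝ}

/-- Mean of `f (run length)` after one more event, for runs of independent events of probability
`q` truncated at `km`, `t` steps after the current run has length `j`. -/
def runMean (q : ℝ) (f : ℕ → ℝ) (km : ℕ) : ℕ → ℕ → ℝ
  | 0, j => f (min (j + 1) km)
  | t + 1, j => q * runMean q f km t (min (j + 1) km) + (1 - q) * runMean q f km t 0

/-- The index i counts the events since the last interruption; the final term is the case of no
interruption, the only one that sees j. -/
theorem runMean_eq (q : ℝ) (f : ℕ → ℝ) (km t : ℕ) : ∀ j,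
    runMean q f km t j = ∑ i ∈ Finset.range t, q ^ i * (1 - q) * f (min (i + 1) km)
      + q ^ t * f (min (j + t + 1) km) := by
  induction t with
  | zero => simp [runMean]
  | succ t ih =>
    intro j
    have e : min (min (j + 1) km + t + 1) km = min (j + (t + 1) + 1) km := by omega
    rw [runMean, ih, ih, Finset.sum_range_succ, e, zero_add]
    ring

/-- After km - 1 uninterrupted steps the next event reaches the cap from any j. Later steps average
a constant. -/
theorem runMean_eq_mu (ν q : ℝ) (hkm : 1 ≤ km) {t : ℕ} (ht : km - 1 ≤ t) : ∀ j,
    runMean q (fun i => (i : ℝ) ^ ν) km t j = mu ν q km := by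
  induction t, ht using Nat.le_induction with
  | base =>
    intro j
    have e : Finset.Icc 1 (km - 1) = Finset.Ico 1 km := by
      ext i; simp only [Finset.mem_Icc, Finset.mem_Ico]; omega
    rw [runMean_eq, mu, e, Finset.sum_Ico_eq_sum_range, min_eq_right (by omega), mul_comm (q ^ _)]
    congr 1
    refine Finset.sum_congr rfl fun i hi => ?_
    have : i < km - 1 := Finset.mem_range.1 hi
    rw [min_eq_left (by omega), add_comm i 1, Nat.add_sub_cancel_left]
    ring
  | succ t _ ih =>
    intro j
    rw [runMean, ih, ih]
    ring

theorem toNat_neg_nextMemory_idle (hkm : 1 < km) (k : ℤ) :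
    (-nextMemory km k .idle).toNat = min ((-k).toNat + 1) km := by
  simp only [nextMemory]
  split_ifs with h
  · rw [abs_of_neg h]; omega
  · omega

theorem toNat_nextMemory_collision (hkm : 1 < km) (k : ℤ) :
    (nextMemory km k .collision).toNat = min (k.toNat + 1) km := by
  simp only [nextMemory]
  split_ifs with h <;> omega

theorem abs_nextMemory_idle (hkm : 1 < km) (k : ℤ) :
    |(nextMemory km k .idle : ℝ)| = ((min ((-k).toNat + 1) km : ℕ) : ℝ) := by
  have h : nextMemory km k .idle ≤ 0 := by
    simp only [nextMemory]
    split_ifs with h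
    · rw [abs_of_neg h]; omega
    · omega
  have e : |nextMemory km k .idle| = ((-nextMemory km k .idle).toNat : ℤ) := by
    rw [abs_of_nonpos h, Int.toNat_of_nonneg (by omega)]
  rw [← toNat_neg_nextMemory_idle hkm, ← Int.cast_abs, e, Int.cast_natCast]

theorem nextMemory_collision_cast (hkm : 1 < km) (k : ℤ) :
    (nextMemory km k .collision : ℝ) = ((min (k.toNat + 1) km : ℕ) : ℝ) := by
  have h := nextMemory_collision_pos hkm k
  have e : nextMemory km k .collision = ((nextMemory km k .collision).toNat : ℤ) := by
    rw [Int.toNat_of_nonneg h.le]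
  rw [e, ← toNat_nextMemory_collision hkm, Int.cast_natCast]

theorem memoryMean_const {p : Outcome → ℝ} (hp : ∑ z, p z = 1) (c : ℝ) (t : ℕ) : ∀ k,
    memoryMean km p (fun _ => c) t k = c := by
  induction t with
  | zero => exact fun _ => rfl
  | succ t ih =>
    intro k
    simp only [memoryMean, ih]
    rw [← Finset.sum_mul, hp, one_mul]

/-- The signed memory decouples: its negative and positive parts are the idle and the collision run,
and each is reset to 0 by any other outcome. The rate is a sum of a function of each, so two scalar
run chains suffice. -/
theorem memoryMean_errorRate (hkm : 1 < km) {p : Outcome → ℝ} (hp : ∑ z, p z = 1) (t : ℕ) : ∀ k,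
    memoryMean km p (errorRate km ν η lbar p) t k = -lbar + p .success
      + (p .idle * (-1 - h0 km ν η *
          runMean (p .idle) (fun i => (i : ℝ) ^ ν) km t (-k).toNat)
        + p .collision * ((Real.exp 1 - 2)⁻¹ + hc km ν η *
          runMean (p .collision) (fun i => (i : ℝ) ^ ν) km t k.toNat)) := by
  induction t with
  | zero =>
    intro k
    simp only [memoryMean, errorRate, runMean, abs_nextMemory_idle hkm,
      nextMemory_collision_cast hkm]
  | succ t ih =>
    intro k
    have h1 : (nextMemory km k .idle).toNat = 0 := by
      simp only [nextMemory]
      split_ifs with h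
      · rw [abs_of_neg h]; omega
      · omega
    have h2 : (-nextMemory km k .collision).toNat = 0 := by
      have := nextMemory_collision_pos hkm k
      omega
    have h3 : nextMemory km k .success = 0 := rfl
    rw [sum_outcome] at hp
    simp only [memoryMean, runMean]
    rw [sum_outcome, ih, ih, ih, toNat_neg_nextMemory_idle hkm, toNat_nextMemory_collision hkm,
      h1, h2, h3, neg_zero, Int.toNat_zero]
    -- For either run the two resetting outcomes together must have weight 1 - q.
    have hs : p .success = 1 - p .idle - p .collision := by linarith
    rw [hs]
    ring

/-- Stationary drift of the estimate error when the outcomes are independent with law `p`. -/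
noncomputable def stationaryRate (km : ℕ) (ν η lbar : ℝ) (p : Outcome → ℝ) : ℝ :=
  -lbar + p .success + (p .idle * (-1 - h0 km ν η * mu ν (p .idle) km)
    + p .collision * ((Real.exp 1 - 2)⁻¹ + hc km ν η * mu ν (p .collision) km))

/-- The memory chain forgets its initial state after `km` slots. -/
theorem memoryMean_errorRate_of_le (hkm : 1 < km) {p : Outcome → ℝ} (hp : ∑ z, p z = 1) {t : ℕ}
    (ht : km ≤ t) (k : ℤ) :
    memoryMean km p (errorRate km ν η lbar p) t k = stationaryRate km ν η lbar p := by
  rw [memoryMean_errorRate hkm hp, runMean_eq_mu ν _ (by omega) (by omega),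
    runMean_eq_mu ν _ (by omega) (by omega), stationaryRate]

theorem stationaryRate_poissonOutcome (r : ℝ) :
    stationaryRate km ν η lbar (poissonOutcome r) = psi km ν η r lbar := by
  simp only [stationaryRate, poissonOutcome, psi, phi, q1]
  ring

theorem sum_poissonOutcome (r : ℝ) : ∑ z, poissonOutcome r z = 1 := by
  rw [sum_outcome]
  simp only [poissonOutcome, qc]
  ring

theorem sum_overloadOutcome : ∑ z, overloadOutcome z = 1 := by
  rw [sum_outcome]
  simp [overloadOutcome]

end RunLength

/-! ### Monotonicity of φ and ψ, the zero β and the margin -/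

section Monotone

variable {km : ℕ} {ν η lbar : ℝ}

theorem mu_one (ν q : ℝ) : mu ν q 1 = 1 := by simp [mu]

/-- Summation by parts for `μ`. -/
theorem mu_succ (ν q : ℝ) (m : ℕ) :
    mu ν q (m + 2) = mu ν q (m + 1) + (((m + 2 : ℕ) : ℝ) ^ ν - ((m + 1 : ℕ) : ℝ) ^ ν)
      * q ^ (m + 1) := by
  simp only [mu, Nat.add_sub_cancel, show m + 2 - 1 = m + 1 from rfl]
  rw [Finset.sum_Icc_succ_top (by omega)]
  simp only [Nat.add_sub_cancel]
  ring

/-- Summation by parts shows μ as a polynomial in q with nonnegative coefficients. -/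
theorem mu_mono (hν : 0 ≤ ν) {q q' : ℝ} (h0 : 0 ≤ q) (h : q ≤ q') (m : ℕ) :
    mu ν q (m + 1) ≤ mu ν q' (m + 1) := by
  induction m with
  | zero => simp [mu_one]
  | succ m ih =>
    rw [mu_succ, mu_succ]
    refine add_le_add ih (mul_le_mul_of_nonneg_left (pow_le_pow_left₀ h0 h _) (sub_nonneg.2 ?_))
    exact Real.rpow_le_rpow (by positivity) (by push_cast; linarith) hν

theorem one_le_mu (hν : 0 ≤ ν) {q : ℝ} (h0 : 0 ≤ q) (m : ℕ) : 1 ≤ mu ν q (m + 1) := by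
  induction m with
  | zero => simp [mu_one]
  | succ m ih =>
    rw [mu_succ]
    refine ih.trans (le_add_of_nonneg_right (mul_nonneg (sub_nonneg.2 ?_) (by positivity)))
    exact Real.rpow_le_rpow (by positivity) (by push_cast; linarith) hν

theorem mul_mu_mono (hkm : 1 < km) (hν : 0 ≤ ν) {q q' : ℝ} (h0 : 0 ≤ q) (h : q ≤ q') :
    q * mu ν q km ≤ q' * mu ν q' km := by
  obtain ⟨m, rfl⟩ : ∃ m, km = m + 1 := ⟨km - 1, by omega⟩
  exact mul_le_mul h (mu_mono hν h0 h m) (zero_le_one.trans (one_le_mu hν h0 m)) (h0.trans h)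

theorem mu_pos (hkm : 1 < km) (hν : 0 ≤ ν) {q : ℝ} (h0 : 0 ≤ q) : 0 < mu ν q km := by
  obtain ⟨m, rfl⟩ : ∃ m, km = m + 1 := ⟨km - 1, by omega⟩
  exact zero_lt_one.trans_le (one_le_mu hν h0 m)

theorem q0_strictAnti : StrictAnti q0 := fun _ _ h => Real.exp_lt_exp.2 (neg_lt_neg h)

/-- Equivalently (1 + r)e^{-r} decreases, from (1 + r)e^{s-r} ≥ (1 + r)(1 + s - r) ≥ 1 + s. -/
theorem qc_mono {r s : ℝ} (hr : 0 ≤ r) (h : r ≤ s) : qc r ≤ qc s := by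
  have h1 : 1 + s ≤ (1 + r) * Real.exp (s - r) := by
    have := Real.add_one_le_exp (s - r)
    nlinarith
  have h2 := mul_le_mul_of_nonneg_right h1 (Real.exp_pos (-s)).le
  rw [mul_assoc, ← Real.exp_add, show s - r + -s = -r by ring] at h2
  simp only [qc, q0, q1]
  linarith

theorem phi_lt_phi (hkm : 1 < km) (hν : 0 ≤ ν) (hη : 0 ≤ η) {r s : ℝ} (hr : 0 ≤ r)
    (h : r < s) : phi km ν η r < phi km ν η s := by
  have a1 := q0_strictAnti h
  have a2 := mul_le_mul_of_nonneg_left (mul_mu_mono hkm hν (q0_nonneg s) a1.le)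
    (h0_nonneg km ν hη)
  have a3 := mul_le_mul_of_nonneg_left (qc_mono hr h.le) (inv_nonneg.2 exp_one_sub_two_pos.le)
  have a4 := mul_le_mul_of_nonneg_left (mul_mu_mono hkm hν (qc_nonneg r) (qc_mono hr h.le))
    (hc_nonneg km ν hη)
  simp only [phi]
  linarith

/-- The term ρe^{-ρ} is not monotone, but it equals 1 - q₀ - q_c. Its -q_c is absorbed by q_c/(e -
2) because e < 3, and strictness comes from q₀. -/
theorem psi_lt_psi (hkm : 1 < km) (hν : 0 ≤ ν) (hη : 0 ≤ η) {r s : ℝ} (hr : 0 ≤ r)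
    (h : r < s) : psi km ν η r lbar < psi km ν η s lbar := by
  have a1 := q0_strictAnti h
  have a2 := mul_le_mul_of_nonneg_left (mul_mu_mono hkm hν (q0_nonneg s) a1.le)
    (h0_nonneg km ν hη)
  have a3 := mul_le_mul_of_nonneg_left (qc_mono hr h.le)
    (sub_nonneg.2 one_le_inv_exp_one_sub_two)
  have a4 := mul_le_mul_of_nonneg_left (mul_mu_mono hkm hν (qc_nonneg r) (qc_mono hr h.le))
    (hc_nonneg km ν hη)
  have e : ∀ r, r * Real.exp (-r) = 1 - q0 r - qc r := fun r => by
    simp only [qc, q1]; ring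
  simp only [psi, phi, e]
  linarith

theorem qc_one_pos : 0 < qc 1 := by
  have h : Real.exp 1 * Real.exp (-1) = 1 := by rw [← Real.exp_add]; simp
  have h2 := mul_pos exp_one_sub_two_pos (Real.exp_pos (-1))
  simp only [qc, q0, q1]
  linarith

/-- By the normalisation of h₀ and h_c both run-length terms equal η and cancel, and q_c(1)/(e - 2)
= e^{-1} = q₀(1). -/
theorem phi_one (hkm : 1 < km) (hν : 0 ≤ ν) : phi km ν η 1 = 0 := by
  have m0 := mu_pos hkm hν (q0_nonneg 1)
  have mc := mu_pos hkm hν (qc_nonneg 1)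
  have p0 : 0 < q0 1 := Real.exp_pos _
  have pc := qc_one_pos
  have e0 : q0 1 * (h0 km ν η * mu ν (q0 1) km) = η := by
    unfold h0; field_simp
  have ec : qc 1 * (hc km ν η * mu ν (qc 1) km) = η := by
    unfold hc; field_simp
  have e : qc 1 * (Real.exp 1 - 2)⁻¹ = q0 1 := by
    rw [← div_eq_mul_inv, div_eq_iff exp_one_sub_two_pos.ne']
    have h : Real.exp (-1) * Real.exp 1 = 1 := by rw [← Real.exp_add]; simp
    simp only [qc, q0, q1]
    linarith
  rw [phi, mul_add, mul_add, e0, ec, e]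
  ring

theorem psi_one (hkm : 1 < km) (hν : 0 ≤ ν) : psi km ν η 1 lbar = Real.exp (-1) - lbar := by
  rw [psi, phi_one hkm hν]
  ring

theorem psi_zero_neg (hkm : 1 < km) (hν : 0 ≤ ν) (hη : 0 ≤ η) (hl : 0 ≤ lbar) :
    psi km ν η 0 lbar < 0 := by
  have h := mul_nonneg (h0_nonneg km ν hη) (mu_pos hkm hν zero_le_one).le
  simp only [psi, phi, qc, q0, q1]
  simp
  linarith

theorem continuous_q0 : Continuous q0 := by unfold q0; fun_prop

theorem continuous_qc : Continuous qc := by unfold qc q0 q1; fun_prop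

theorem continuous_mu (ν : ℝ) (km : ℕ) : Continuous fun q => mu ν q km := by
  unfold mu; fun_prop

theorem continuous_psi (km : ℕ) (ν η lbar : ℝ) : Continuous fun r => psi km ν η r lbar := by
  have h1 := (continuous_mu ν km).comp continuous_q0
  have h2 := (continuous_mu ν km).comp continuous_qc
  have h3 := continuous_q0
  have h4 := continuous_qc
  simp only [Function.comp_def] at h1 h2
  unfold psi phi
  fun_prop

/-- The zero of `ψ`, and the positive margin of the success probability over the arrival rate
between it and `1`. -/
theorem exists_zero_psi (hkm : 1 < km) (hν : 0 ≤ ν) (hη : 0 ≤ η) (hpos : 0 ≤ lbar)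
    (hlt : lbar < Real.exp (-1)) :
    ∃ β, 0 < β ∧ β < 1 ∧ psi km ν η β lbar = 0 ∧
      (∀ ρ, 0 < ρ → ρ ≤ 1 → psi km ν η ρ lbar = 0 → ρ = β) ∧
      ∀ r ∈ Set.Icc β 1, lbar < r * Real.exp (-r) := by
  have h0 := psi_zero_neg hkm hν hη hpos
  have h1 : 0 < psi km ν η 1 lbar := by rw [psi_one hkm hν]; linarith
  obtain ⟨β, ⟨hβ0, hβ1⟩, hβ⟩ := intermediate_value_Ioo zero_le_one
    (continuous_psi km ν η lbar).continuousOn ⟨h0, h1⟩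
  refine ⟨β, hβ0, hβ1, hβ, fun ρ hρ _ h => ?_, fun r hr => ?_⟩
  · rcases lt_trichotomy ρ β with hl | rfl | hl
    · have := psi_lt_psi (lbar := lbar) hkm hν hη hρ.le hl
      simp only at hβ
      linarith
    · rfl
    · have := psi_lt_psi (lbar := lbar) hkm hν hη hβ0.le hl
      simp only at hβ
      linarith
  -- For r < 1, re^{-r} - λ̄ = ψ(r) - φ(r) with ψ(r) ≥ 0 > φ(r). At r = 1 the claim is the
  -- hypothesis on λ̄.
  · rcases hr.2.eq_or_lt with rfl | hr1
    · simpa using hlt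
    · have a := phi_lt_phi hkm hν hη (hβ0.le.trans hr.1) hr1
      rw [phi_one hkm hν] at a
      have b : 0 ≤ psi km ν η r lbar := by
        rcases hr.1.eq_or_lt with rfl | hlt
        · exact hβ.ge
        · exact hβ.ge.trans (psi_lt_psi hkm hν hη hβ0.le hlt).le
      rw [psi] at b
      linarith

/-- The margin persists on a neighbourhood of `[β, 1]`. -/
theorem exists_margin {β lbar : ℝ} (hβ : 0 < β) (hβ1 : β < 1)
    (h : ∀ r ∈ Set.Icc β 1, lbar < r * Real.exp (-r)) :
    ∃ γ ε, 0 < γ ∧ 0 < ε ∧ 5 * γ < β ∧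
      ∀ r ∈ Set.Icc (β - 5 * γ) (1 + 5 * γ), lbar + ε ≤ r * Real.exp (-r) := by
  have hc : Continuous fun r : ℝ => r * Real.exp (-r) := by fun_prop
  obtain ⟨δ, hδ, hsub⟩ := isCompact_Icc.exists_cthickening_subset_open
    (isOpen_lt continuous_const hc) h
  -- The cap β/2 ensures 5γ < β; δ keeps the enlarged interval inside the open set where the margin
  -- is positive.
  have hγ : 0 < min δ (β / 2) / 5 := by positivity
  have h5 : 5 * (min δ (β / 2) / 5) = min δ (β / 2) := by ring
  refine ⟨min δ (β / 2) / 5, ?_⟩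
  rw [h5]
  have hd := min_le_left δ (β / 2)
  have hb := min_le_right δ (β / 2)
  set d := min δ (β / 2)
  have hin : ∀ r ∈ Set.Icc (β - d) (1 + d), lbar < r * Real.exp (-r) := fun r hr => by
    refine hsub (Metric.mem_cthickening_of_dist_le r (max β (min r 1)) δ _
      ⟨le_max_left _ _, max_le hβ1.le (min_le_right _ _)⟩ ?_)
    rw [Real.dist_eq, abs_le]
    rcases le_total r 1 with h1 | h1 <;> rcases le_total β r with h2 | h2 <;>
      simp only [min_eq_left, min_eq_right, max_eq_left, max_eq_right, h1, h2, hβ1.le] <;>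
      constructor <;> linarith [hr.1, hr.2]
  obtain ⟨r₀, hr₀, hmin⟩ := isCompact_Icc.exists_isMinOn
    (Set.nonempty_Icc.2 (by linarith : β - d ≤ 1 + d)) hc.continuousOn
  refine ⟨r₀ * Real.exp (-r₀) - lbar, hγ, sub_pos.2 (hin r₀ hr₀), by linarith, fun r hr => ?_⟩
  have := isMinOn_iff.1 hmin r hr
  linarith

/-- With collisions only, each slot adds at least 1/(e - 2) ≥ 1 ≥ e^{-1}, so a δ chosen for ψ(1)
also serves infinite load. -/
theorem psi_one_le_stationaryRate_overload (hkm : 1 < km) (hν : 0 ≤ ν) (hη : 0 ≤ η) :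
    psi km ν η 1 lbar ≤ stationaryRate km ν η lbar overloadOutcome := by
  have h1 := mul_nonneg (hc_nonneg km ν hη) (mu_pos hkm hν zero_le_one).le
  have h2 : Real.exp (-1) ≤ 1 := by simp
  have h3 := one_le_inv_exp_one_sub_two
  rw [psi_one hkm hν]
  simp only [stationaryRate, overloadOutcome]
  linarith

end Monotone

/-! ### Uniform drift bounds by ultrafilter compactness -/

section Compactness

variable {km : ℕ} {ν η : ℝ} {θ : unitInterval} {lam : ℝ≥0}

/-- Otherwise each j has a counterexample, and along the hyperfilter the limit of `D` would be at
least c. The ultrafilter replaces successive extraction of subsequences. -/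
theorem exists_threshold {A : ℝ → Set State} {D : State → ℝ} {c : ℝ}
    (h : ∀ (U : Ultrafilter ℕ) (X : ℕ → State), (U : Filter ℕ) ≤ atTop → (∀ j : ℕ, X j ∈ A j) →
      ∃ m, Tendsto (fun j => D (X j)) U (𝓝 m) ∧ m < c) :
    ∃ j : ℕ, ∀ x ∈ A j, D x ≤ c := by
  by_contra! hc
  choose X hX hD using hc
  obtain ⟨m, hm, hlt⟩ := h (hyperfilter ℕ) X Nat.hyperfilter_le_atTop hX
  exact hlt.not_ge (ge_of_tendsto hm (Eventually.of_forall fun j => (hD j).le))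

/-- Along an ultrafilter on which `n + n̂` tends to infinity, the load has a limit in `[0, ∞]`. -/
theorem finiteLoad_or_overload {U : Ultrafilter ℕ} {X : ℕ → State}
    (hst : ∀ j, X j ∈ stateSpace km)
    (hM : Tendsto (fun j => estimate (X j) + backlog (X j)) U atTop) :
    ∃ k, (∃ r, 0 ≤ r ∧ FiniteLoad U r X k) ∨ Overload U X k := by
  have h1 : ∀ j, 1 ≤ estimate (X j) := fun j => (hst j).1
  obtain ⟨k, -, hk⟩ := (isCompact_Icc (a := -(km : ℤ)) (b := km)).ultrafilter_le_nhds
    (U.map fun j => memory (X j))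
    (le_principal_iff.2 (Ultrafilter.mem_map.2
      (univ_mem' fun j => ⟨(hst j).2.1, (hst j).2.2⟩)))
  have hmem : ∀ᶠ j in (U : Filter ℕ), memory (X j) = k := by
    have : Tendsto (fun j => memory (X j)) U (𝓝 k) := hk
    rw [nhds_discrete] at this
    exact tendsto_pure.1 this
  have hρ0 : ∀ j, 0 ≤ (backlog (X j) : ℝ) / estimate (X j) := fun j =>
    div_nonneg (Nat.cast_nonneg _) (by linarith [h1 j])
  refine ⟨k, ?_⟩
  by_cases ht : Tendsto (fun j => (backlog (X j) : ℝ) / estimate (X j)) U atTop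
  · exact .inr ⟨h1, ht, hmem⟩
  rw [tendsto_atTop] at ht
  -- Along an ultrafilter, what is not eventually true is eventually false: the load is eventually
  -- below some c.
  push Not at ht
  obtain ⟨c, hc⟩ := ht
  obtain ⟨r, hr, hlim⟩ := (isCompact_Icc (a := (0 : ℝ)) (b := c)).ultrafilter_le_nhds
    (U.map fun j => (backlog (X j) : ℝ) / estimate (X j))
    (le_principal_iff.2 (Ultrafilter.mem_map.2 (hc.mono fun j hj => ⟨hρ0 j, hj.le⟩)))
  refine .inl ⟨r, hr.1, h1, ?_, hlim, hmem⟩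
  have hc0 : 0 ≤ c := hr.1.trans hr.2
  -- Load below c gives n̂ + n ≤ (1 + c)n̂, so n̂ itself tends to infinity.
  refine tendsto_atTop_mono' _ ?_ (hM.atTop_div_const (by linarith : 0 < 1 + c))
  filter_upwards [hc] with j hj
  have := h1 j
  rw [div_lt_iff₀ (by linarith)] at hj
  rw [div_le_iff₀ (by linarith)]
  linarith

/-- The limiting one-slot drift does not involve the memory, so every slot contributes equally,
without a transient. -/
theorem FiniteLoad.tendsto_sum_driftAt_backlog (hkm : 1 < km) (hν : 0 ≤ ν) (hη : 0 ≤ η)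
    {ι : Type*} {l : Filter ι} {r : ℝ} {X : ι → State} {k : ℤ} (h : FiniteLoad l r X k) (T : ℕ) :
    Tendsto (fun j => ∑ t ∈ Finset.range T,
        driftAt km ν η θ lam (fun x => (backlog x : ℝ)) t (X j)) l
      (𝓝 (T * ((θ : ℝ) * lam - q1 r))) := by
  have e : ∀ t, Tendsto (fun j => driftAt km ν η θ lam (fun x => (backlog x : ℝ)) t (X j)) l
      (𝓝 ((θ : ℝ) * lam - q1 r)) := fun t => by
    have := tendsto_driftAt (l := l) (θ := θ) (lam := lam) hkm hη
      (incrementBound_backlog (km := km) (ν := ν) (η := η)) (p := poissonOutcome r)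
      (e := fun _ => (θ : ℝ) * lam - q1 r) (S := FiniteLoad l r)
      (fun X k hX a z => hX.next hkm hν hη a z) (fun X k hX => hX.one_le)
      (fun X k hX => hX.tendsto_outcomeProb) (fun X k hX => by
        simp only [fun j => driftAt_backlog_zero (km := km) (ν := ν) (η := η) (θ := θ)
          (lam := lam) (hX.one_le j)]
        exact tendsto_const_nhds.sub (hX.tendsto_outcomeProb .success)) t X k h
    rwa [memoryMean_const (sum_poissonOutcome r)] at this
  simpa [mul_sub] using tendsto_finsetSum (Finset.range T) fun t _ => e t

/-- If the drifts converge to those of the memory chain, their sums over `km + s` slots are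
`s` times the stationary rate, up to the contribution of the first `km` slots. -/
theorem exists_tendsto_sum_driftAt_errorOf (hkm : 1 < km) (hν : 0 ≤ ν) (hη : 0 ≤ η)
    {ι : Type*} {l : Filter ι} [l.NeBot] {X : ι → State} (hX : ∀ j, 1 ≤ estimate (X j)) {k : ℤ}
    {p : Outcome → ℝ} (hp : ∑ z, p z = 1)
    (h : ∀ t, Tendsto (fun j => driftAt km ν η θ lam errorOf t (X j)) l
      (𝓝 (memoryMean km p (errorRate km ν η ((θ : ℝ) * lam) p) t k))) (s : ℕ) :
    ∃ m, Tendsto (fun j => ∑ t ∈ Finset.range (km + s), driftAt km ν η θ lam errorOf t (X j)) l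
        (𝓝 m) ∧
      |m - s * stationaryRate km ν η ((θ : ℝ) * lam) p|
        ≤ km * ((1 + estimateBound km ν η) * (1 + (θ : ℝ) * lam)) := by
  refine ⟨_, tendsto_finsetSum _ fun t _ => h t, ?_⟩
  rw [Finset.sum_range_add]
  simp only [memoryMean_errorRate_of_le hkm hp (Nat.le_add_right km _)]
  rw [Finset.sum_const, Finset.card_range, nsmul_eq_mul, add_sub_cancel_right]
  refine (Finset.abs_sum_le_sum_abs _ _).trans ((Finset.sum_le_sum fun t _ =>
    abs_memoryMean_le hkm hη (incrementBound_errorOf hkm hν hη) hX (h t)).trans_eq ?_)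
  simp

theorem FiniteLoad.tendsto_driftAt_errorOf (hkm : 1 < km) (hν : 0 ≤ ν) (hη : 0 ≤ η)
    {ι : Type*} {l : Filter ι} {r : ℝ} {X : ι → State} {k : ℤ} (h : FiniteLoad l r X k) (t : ℕ) :
    Tendsto (fun j => driftAt km ν η θ lam errorOf t (X j)) l
      (𝓝 (memoryMean km (poissonOutcome r)
        (errorRate km ν η ((θ : ℝ) * lam) (poissonOutcome r)) t k)) :=
  tendsto_driftAt hkm hη (incrementBound_errorOf hkm hν hη) (S := FiniteLoad l r)
    (fun _ _ hX a z => hX.next hkm hν hη a z) (fun _ _ hX => hX.one_le)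
    (fun _ _ hX => hX.tendsto_outcomeProb) (fun _ _ hX => hX.tendsto_driftAt_errorOf_zero) t X k h

theorem Overload.tendsto_driftAt_errorOf (hkm : 1 < km) (hν : 0 ≤ ν) (hη : 0 ≤ η)
    {ι : Type*} {l : Filter ι} {X : ι → State} {k : ℤ} (h : Overload l X k) (t : ℕ) :
    Tendsto (fun j => driftAt km ν η θ lam errorOf t (X j)) l
      (𝓝 (memoryMean km overloadOutcome
        (errorRate km ν η ((θ : ℝ) * lam) overloadOutcome) t k)) :=
  tendsto_driftAt hkm hη (incrementBound_errorOf hkm hν hη) (S := Overload l)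
    (fun _ _ hX a z => hX.next hkm hν hη a z) (fun _ _ hX => hX.one_le)
    (fun _ _ hX => hX.tendsto_outcomeProb)
    (fun _ _ hX => hX.tendsto_driftAt_errorOf_zero hkm hν hη) t X k h

theorem backlogDrift_eq_sum (hkm : 1 < km) (hη : 0 ≤ η) (T : ℕ) {x : State}
    (hx : 1 ≤ estimate x) : backlogDrift km ν η θ lam T x
      = ∑ t ∈ Finset.range T, driftAt km ν η θ lam (fun x => (backlog x : ℝ)) t x :=
  integral_transition hη hkm incrementBound_backlog T hx

theorem errorDrift_eq_sum (hkm : 1 < km) (hν : 0 ≤ ν) (hη : 0 ≤ η) (T : ℕ) {x : State}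
    (hx : 1 ≤ estimate x) : errorDrift km ν η θ lam T x
      = ∑ t ∈ Finset.range T, driftAt km ν η θ lam errorOf t x :=
  integral_transition hη hkm (incrementBound_errorOf hkm hν hη) T hx

theorem tendsto_estimate_add_backlog {U : Ultrafilter ℕ} (hU : (U : Filter ℕ) ≤ atTop)
    {X : ℕ → State} (h1 : ∀ j, 1 ≤ estimate (X j))
    (h : ∀ j : ℕ, (j : ℝ) ≤ backlog (X j) ∨ (j : ℝ) ≤ estimate (X j)) :
    Tendsto (fun j => estimate (X j) + backlog (X j)) U atTop := by
  refine tendsto_atTop_mono (fun j => ?_) ((tendsto_natCast_atTop_atTop (R := ℝ)).mono_left hU)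
  have := h1 j
  have : (0 : ℝ) ≤ backlog (X j) := Nat.cast_nonneg _
  rcases h j with h | h <;> linarith

theorem not_overload_of_le {U : Ultrafilter ℕ} {X : ℕ → State} {k : ℤ} {c : ℝ}
    (h : ∀ j, (backlog (X j) : ℝ) / estimate (X j) ≤ c) : ¬ Overload U X k := fun ho => by
  obtain ⟨j, hj⟩ := (ho.tendsto_load.eventually_gt_atTop c).exists
  exact (h j).not_gt hj

variable {β γ δ : ℝ}

theorem exists_threshold_regionS (hkm : 1 < km) (hν : 0 ≤ ν) (hη : 0 ≤ η) {T : ℕ} (hT : 0 < T)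
    (h : ∀ r ∈ Set.Icc (β - γ) (1 + γ), (θ : ℝ) * lam + δ < r * Real.exp (-r)) :
    ∃ j : ℕ, ∀ x ∈ regionS km β γ j, backlogDrift km ν η θ lam T x ≤ -((T : ℝ) * δ) := by
  refine exists_threshold fun U X hU hX => ?_
  have h1 : ∀ j, 1 ≤ estimate (X j) := fun j => (hX j).1.1
  obtain ⟨k, ⟨r, -, hr⟩ | ho⟩ := finiteLoad_or_overload (fun j => (hX j).1)
    (tendsto_estimate_add_backlog hU h1 fun j => (hX j).2.1)
  · refine ⟨T * ((θ : ℝ) * lam - q1 r), ?_, ?_⟩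
    · simp only [backlogDrift_eq_sum hkm hη T (h1 _)]
      exact hr.tendsto_sum_driftAt_backlog hkm hν hη T
    · have := h r ⟨ge_of_tendsto hr.tendsto_load (Eventually.of_forall fun j => (hX j).2.2.1),
        le_of_tendsto hr.tendsto_load (Eventually.of_forall fun j => (hX j).2.2.2)⟩
      have hT' : (0 : ℝ) < T := Nat.cast_pos.2 hT
      rw [← mul_neg]
      refine mul_lt_mul_of_pos_left ?_ hT'
      rw [q1]
      linarith
  · exact absurd ho (not_overload_of_le fun j => (hX j).2.2.2)

/-- The first `km` slots cost at most km·B and the next s gain 2δ each. The condition km(B + δ) < sδ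
is exactly what leaves more than δ per slot over all km + s. -/
theorem exists_threshold_regionRminus (hkm : 1 < km) (hν : 0 ≤ ν) (hη : 0 ≤ η) {s : ℕ}
    (hψ : psi km ν η (β - γ) ((θ : ℝ) * lam) ≤ -(2 * δ))
    (hs : km * ((1 + estimateBound km ν η) * (1 + (θ : ℝ) * lam) + δ) < s * δ) :
    ∃ j : ℕ, ∀ x ∈ regionRminus km β γ j,
      errorDrift km ν η θ lam (km + s) x ≤ -(((km + s : ℕ) : ℝ) * δ) := by
  refine exists_threshold fun U X hU hX => ?_
  have h1 : ∀ j, 1 ≤ estimate (X j) := fun j => (hX j).1.1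
  obtain ⟨k, ⟨r, hr0, hr⟩ | ho⟩ := finiteLoad_or_overload (fun j => (hX j).1)
    (tendsto_estimate_add_backlog hU h1 fun j => .inr (hX j).2.1)
  · obtain ⟨m, hm, hms⟩ := exists_tendsto_sum_driftAt_errorOf hkm hν hη h1 (sum_poissonOutcome r)
      (fun t => hr.tendsto_driftAt_errorOf (θ := θ) (lam := lam) hkm hν hη t) s
    refine ⟨m, by simpa only [errorDrift_eq_sum hkm hν hη _ (h1 _)] using hm, ?_⟩
    have hle : r ≤ β - γ :=
      le_of_tendsto hr.tendsto_load (Eventually.of_forall fun j => (hX j).2.2.le)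
    have hψr : psi km ν η r ((θ : ℝ) * lam) ≤ -(2 * δ) := by
      rcases hle.eq_or_lt with rfl | hlt
      · exact hψ
      · exact (psi_lt_psi hkm hν hη hr0 hlt).le.trans hψ
    rw [stationaryRate_poissonOutcome] at hms
    have := mul_le_mul_of_nonneg_left hψr (Nat.cast_nonneg (α := ℝ) s)
    have := (abs_le.1 hms).2
    push_cast
    linarith
  · exact absurd ho (not_overload_of_le fun j => (hX j).2.2.le)

/-- Only here can the load be unbounded, so both regimes occur; in each the stationary rate is at
least ψ(1). -/
theorem exists_threshold_regionRplus (hkm : 1 < km) (hν : 0 ≤ ν) (hη : 0 ≤ η) {s : ℕ}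
    (hγ : 0 < γ) (hψ : 2 * δ ≤ psi km ν η 1 ((θ : ℝ) * lam))
    (hs : km * ((1 + estimateBound km ν η) * (1 + (θ : ℝ) * lam) + δ) < s * δ) :
    ∃ j : ℕ, ∀ x ∈ regionRplus km γ j,
      ((km + s : ℕ) : ℝ) * δ ≤ errorDrift km ν η θ lam (km + s) x := by
  have key := exists_threshold (A := regionRplus km γ)
    (D := fun x => -errorDrift km ν η θ lam (km + s) x) (c := -(((km + s : ℕ) : ℝ) * δ))
    fun U X hU hX => ?_
  · exact key.imp fun j hj x hx => neg_le_neg_iff.1 (hj x hx)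
  have h1 : ∀ j, 1 ≤ estimate (X j) := fun j => (hX j).1.1
  have hfinish : ∀ {k p}, (∑ z, p z = 1) → (∀ t, Tendsto (fun j =>
      driftAt km ν η θ lam errorOf t (X j)) U
        (𝓝 (memoryMean km p (errorRate km ν η ((θ : ℝ) * lam) p) t k))) →
      2 * δ ≤ stationaryRate km ν η ((θ : ℝ) * lam) p →
      ∃ m, Tendsto (fun j => -errorDrift km ν η θ lam (km + s) (X j)) U (𝓝 m) ∧
        m < -(((km + s : ℕ) : ℝ) * δ) := by
    intro k p hp ht hrate
    obtain ⟨m, hm, hms⟩ := exists_tendsto_sum_driftAt_errorOf hkm hν hη h1 hp ht s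
    refine ⟨-m, by simpa only [errorDrift_eq_sum hkm hν hη _ (h1 _)] using hm.neg, ?_⟩
    have := mul_le_mul_of_nonneg_left hrate (Nat.cast_nonneg (α := ℝ) s)
    have := (abs_le.1 hms).1
    push_cast
    linarith
  obtain ⟨k, ⟨r, -, hr⟩ | ho⟩ := finiteLoad_or_overload (fun j => (hX j).1)
    (tendsto_estimate_add_backlog hU h1 fun j => .inl (hX j).2.1)
  · refine hfinish (sum_poissonOutcome r)
      (fun t => hr.tendsto_driftAt_errorOf (θ := θ) (lam := lam) hkm hν hη t) ?_
    have hle : 1 + γ ≤ r :=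
      ge_of_tendsto hr.tendsto_load (Eventually.of_forall fun j => (hX j).2.2.le)
    rw [stationaryRate_poissonOutcome]
    exact hψ.trans (psi_lt_psi hkm hν hη zero_le_one (by linarith)).le
  · exact hfinish sum_overloadOutcome
      (fun t => ho.tendsto_driftAt_errorOf (θ := θ) (lam := lam) hkm hν hη t)
      (hψ.trans (psi_one_le_stationaryRate_overload hkm hν hη))

end Compactness

end FASA

/-! ### Choice of the constants -/

theorem lemma4 (km : ℕ) (hkm : 1 < km) (ν η : ℝ) (hν : 0 < ν) (hη : 0 < η)
    (θ : unitInterval) (lam : ℝ≥0)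
    (hpos : 0 < (θ : ℝ) * (lam : ℝ)) (hlt : (θ : ℝ) * (lam : ℝ) < Real.exp (-1)) :
    ∃ β : ℝ, (0 < β ∧ β ≤ 1 ∧ FASA.psi km ν η β ((θ : ℝ) * (lam : ℝ)) = 0 ∧
        ∀ ρ : ℝ, 0 < ρ → ρ ≤ 1 → FASA.psi km ν η ρ ((θ : ℝ) * (lam : ℝ)) = 0 → ρ = β) ∧
      ∃ (γ δ : ℝ) (T : ℕ) (M : ℝ), 0 < γ ∧ 0 < δ ∧ 0 < T ∧ 0 < M ∧ 5 * γ < β ∧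
        (∀ x ∈ FASA.regionS km β (5 * γ) M,
          FASA.backlogDrift km ν η θ lam T x ≤ -((T : ℝ) * δ)) ∧
        (∀ x ∈ FASA.regionRminus km β γ M,
          FASA.errorDrift km ν η θ lam T x ≤ -((T : ℝ) * δ)) ∧
        (∀ x ∈ FASA.regionRplus km γ M,
          (T : ℝ) * δ ≤ FASA.errorDrift km ν η θ lam T x) := by
  obtain ⟨β, hβ0, hβ1, hβ, huniq, hmargin⟩ :=
    FASA.exists_zero_psi hkm hν.le hη.le hpos.le hlt
  obtain ⟨γ, ε, hγ, hε, hγβ, hε'⟩ := FASA.exists_margin hβ0 hβ1 hmargin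
  have hneg : FASA.psi km ν η (β - γ) ((θ : ℝ) * lam) < 0 := by
    rw [← hβ]
    exact FASA.psi_lt_psi hkm hν.le hη.le (by linarith) (by linarith)
  have hone : 0 < FASA.psi km ν η 1 ((θ : ℝ) * lam) := by
    rw [FASA.psi_one hkm hν.le]
    linarith
  obtain ⟨δ, hδ, hδε, hδm, hδp⟩ : ∃ δ : ℝ, 0 < δ ∧ δ < ε ∧
      2 * δ ≤ -FASA.psi km ν η (β - γ) ((θ : ℝ) * lam) ∧ 2 * δ ≤ FASA.psi km ν η 1 ((θ : ℝ) * lam) := by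
    -- Half of this minimum leaves a spare δ per slot, from which the transient of the memory is
    -- paid.
    set a := min ε (min (-FASA.psi km ν η (β - γ) ((θ : ℝ) * lam)) (FASA.psi km ν η 1 ((θ : ℝ) * lam)))
    have ha : 0 < a := lt_min hε (lt_min (neg_pos.2 hneg) hone)
    have h1 : a ≤ ε := min_le_left _ _
    have h2 : a ≤ min _ _ := min_le_right _ _
    exact ⟨a / 2, by linarith, by linarith, by linarith [h2.trans (min_le_left _ _)],
      by linarith [h2.trans (min_le_right _ _)]⟩
  obtain ⟨s, hs⟩ := exists_nat_gt
    (km * ((1 + FASA.estimateBound km ν η) * (1 + (θ : ℝ) * lam) + δ) / δ)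
  rw [div_lt_iff₀ hδ] at hs
  obtain ⟨j₁, h₁⟩ := FASA.exists_threshold_regionS (β := β) (γ := 5 * γ) (δ := δ) (T := km + s)
    hkm hν.le hη.le (by omega) fun r hr => by linarith [hε' r hr]
  obtain ⟨j₂, h₂⟩ := FASA.exists_threshold_regionRminus (β := β) (γ := γ) hkm hν.le hη.le
    (by linarith) hs
  obtain ⟨j₃, h₃⟩ := FASA.exists_threshold_regionRplus hkm hν.le hη.le hγ hδp hs
  have n₁ : (0 : ℝ) ≤ j₁ := Nat.cast_nonneg _
  have n₂ : (0 : ℝ) ≤ j₂ := Nat.cast_nonneg _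
  have n₃ : (0 : ℝ) ≤ j₃ := Nat.cast_nonneg _
  -- The regions shrink as M grows, so the sum of the thresholds serves all three; the extra 1 makes
  -- it positive.
  refine ⟨β, ⟨hβ0, hβ1.le, hβ, huniq⟩, γ, δ, km + s, j₁ + j₂ + j₃ + 1, hγ, hδ, by omega,
    by positivity, hγβ, fun x hx => h₁ x ?_, fun x hx => h₂ x ?_, fun x hx => h₃ x ?_⟩
  · exact ⟨hx.1, hx.2.1.imp (fun h => by linarith) fun h => by linarith, hx.2.2⟩
  · exact ⟨hx.1, by linarith [hx.2.1], hx.2.2⟩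
  · exact ⟨hx.1, by linarith [hx.2.1], hx.2.2⟩
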